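/- Let $\mathbb P^1$ be covered by the two standard charts $\mathbb C_z$ and $\mathbb C_w$, $w=1/z$, and let $\mathbb D\subset\mathbb C$ be the open unit disc. Normalise $dd^c=\frac{i}{2\pi}\partial\bar\partial$, so that $dd^c\log|z|^2=\delta_0$, and let $\omega_{FS}$ be the Fubini–Study form, $\omega_{FS}=dd^c\log(1+|z|^2)$ on $\mathbb C_z$, so that $\int_{\mathbb P^1}\omega_{FS}=1$. Let $\pi:\mathbb P^1\times\overline{\mathbb D}\to\mathbb P^1$ be the projection. An arc in $\mathbb C$ is the image of an injective smooth map $[0,1]\to\mathbb C$. **Theorem 2.1.** Suppose that $\phi\in C^\infty(\mathbb P^1)$ is real-valued and satisfies 1. $\omega_{FS}+dd^c\phi>0$; 2. on $\mathbb C_w\subset\mathbb P^1$ one has $\phi\ge-\ln(1+|w|^2)$, and the set of points of $\mathbb C_w$ where equality holds is an arc in $\mathbb C_w$. For $\tau\in\partial\mathbb D$ put $\phi_\tau(z)=\phi(\tau z)$, and let $\Phi$ be the weak solution of the Dirichlet problem for the homogeneous Monge–Ampère equation $$\Phi(\cdot,\tau)=\phi_\tau\ (\tau\in\partial\mathbb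 D),\qquad \pi^*\omega_{FS}+dd^c\Phi\ge0,\qquad (\pi^*\omega_{FS}+dd^c\Phi)^2=0$$ on $\mathbb P^1\times\overline{\mathbb D}$, defined as the pointwise supremum of all upper semicontinuous $\psi:\mathbb P^1\times\overline{\mathbb D}\to\mathbb R\cup\{-\infty\}$ such that $\pi^*\omega_{FS}+dd^c\psi\ge0$ on $\mathbb P^1\times\mathbb D$ and $\psi(z,\tau)\le\phi(\tau z)$ for all $(z,\tau)\in\mathbb P^1\times\partial\mathbb D$. Then $\Phi$ does not have maximal rank: it is not true that for every $\tau\in\overline{\mathbb D}$ the current $\omega_{FS}+dd^c\Phi(\cdot,\tau)$ on $\mathbb P^1$ is strictly positive (that is, $\ge\varepsilon\,\omega_{FS}$ for some $\varepsilon>0$). In fact there is a non-empty open set $S\subset\mathbb P^1\times\mathbb D$ such that $\pi^*\omega_{FS}+dd^c\Phi=0$ on $S$ in the sense of currents. -/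

import Mathlib

open Set Metric MeasureTheory Filter Topology
open scoped ContDiff

noncomputable section

/-- The complex projective line `ℙ¹ = ℂ_z ∪ {∞}`, as the one-point compactification of `ℂ_z`. -/
abbrev P1 : Type := OnePoint ℂ

namespace P1

/-- The chart `ℂ_z → ℙ¹`. -/
def chartZ (z : ℂ) : P1 := (z : OnePoint ℂ)

/-- The chart `ℂ_w → ℙ¹`, where `w = 1 / z`; the point `w = 0` is `z = ∞`. -/
def chartW (w : ℂ) : P1 := if w = 0 then OnePoint.infty else ((w⁻¹ : ℂ) : OnePoint ℂ)

/-- The standard cover of `ℙ¹` by two charts. -/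
def charts : Set (ℂ → P1) := {chartZ, chartW}

/-- Smooth real functions on `ℙ¹` (that is, smooth in both charts). -/
def Smooth (φ : P1 → ℝ) : Prop := ∀ κ ∈ charts, ContDiff ℝ ∞ (fun ζ => φ (κ ζ))

/-- The map `z ↦ τ z` of `ℙ¹` (used for `|τ| = 1`); it fixes `0` and `∞`. -/
def rot (τ : ℂ) : P1 → P1 := OnePoint.map (fun z => τ * z)

/-- The local potential `log (1 + |ζ|²)` of the Fubini-Study form, which is the same in the
coordinate `z` and in the coordinate `w`. -/
def fsPotential (ζ : ℂ) : ℝ := Real.log (1 + ‖ζ‖ ^ 2)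

end P1

/-- An arc in `ℂ`: the image of a smooth map `[0,1] → ℂ` without self-intersections. -/
def IsArc (A : Set ℂ) : Prop :=
  ∃ γ : ℝ → ℂ, ContDiffOn ℝ ∞ γ (Icc 0 1) ∧ InjOn γ (Icc 0 1) ∧ A = γ '' Icc 0 1

/-- For smooth `χ`, the form `dd^c χ` at `p` in the direction `b`: the density, at `ζ = 0` and with
respect to `dx ∧ dy`, of the pull-back of `dd^c χ` to the complex line `ζ ↦ p + ζ b`.
The normalisation is `dd^c = (i / 2π) ∂∂̄`, so that `dd^c log |z|² = δ₀`; on `ℂ` this means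
`dd^c u = (1 / 4π) (Δ u) dx ∧ dy`. In coordinates `ddc χ p b = (1/π) ∑ (∂²χ/∂z_j∂z̄_k)(p) b_j b̄_k`, so
the numbers `ddc χ p b`, for all `b`, determine `dd^c χ` at `p`. -/
def ddc {E : Type*} [NormedAddCommGroup E] [NormedSpace ℂ E] (χ : E → ℝ) (p b : E) : ℝ :=
  (1 / (4 * Real.pi)) * Laplacian.laplacian (fun ζ : ℂ => χ (p + ζ • b)) 0

/-- Plurisubharmonic functions on an open set `U`, with values in `ℝ ∪ {-∞}` (the constant `-∞` is
allowed): upper semicontinuous, with the sub-mean-value inequality on every closed complex disc in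
`U`. The mean over the circle of an upper semicontinuous function `v < +∞` is the infimum of the
means of its continuous majorants `g`, and the inequality is written in that form. -/
def PlurisubharmonicOn {E : Type*} [NormedAddCommGroup E] [NormedSpace ℂ E]
    (u : E → EReal) (U : Set E) : Prop :=
  UpperSemicontinuousOn u U ∧ (∀ p ∈ U, u p ≠ ⊤) ∧
    ∀ a b : E, (∀ ζ ∈ closedBall (0 : ℂ) 1, a + ζ • b ∈ U) →
      ∀ g : ℂ → ℝ, ContinuousOn g (sphere 0 1) →
        (∀ ζ ∈ sphere (0 : ℂ) 1, u (a + ζ • b) ≤ (g ζ : EReal)) →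
          u a ≤ ((Real.circleAverage g 0 1 : ℝ) : EReal)

namespace HMAE

open P1

/-- `ω_FS + dd^c φ > 0` for smooth `φ` on `ℙ¹`. -/
def IsKahlerPotential (φ : P1 → ℝ) : Prop :=
  ∀ κ ∈ charts, ∀ ζ : ℂ, 0 < ddc (fun ξ => fsPotential ξ + φ (κ ξ)) ζ 1

/-- `π^* ω_FS + dd^c ψ ≥ 0` on `ℙ¹ × 𝔻`: adding to `ψ` a local potential of `ω_FS` gives a
plurisubharmonic function. -/
def IsOmegaPsh (ψ : P1 × ℂ → EReal) : Prop :=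
  ∀ κ ∈ charts, PlurisubharmonicOn
    (fun q : ℂ × ℂ => (fsPotential q.1 : EReal) + ψ (κ q.1, q.2)) (univ ×ˢ ball 0 1)

/-- The competitors in the Dirichlet problem on `ℙ¹ × 𝔻̄` with boundary data `F (·, τ)`, `|τ| = 1`.
Only the values of `ψ` on `ℙ¹ × 𝔻̄` play a role. -/
def IsCandidate (F : P1 × ℂ → ℝ) (ψ : P1 × ℂ → EReal) : Prop :=
  UpperSemicontinuousOn ψ (univ ×ˢ closedBall 0 1) ∧
    (∀ p ∈ (univ ×ˢ closedBall 0 1 : Set (P1 × ℂ)), ψ p ≠ ⊤) ∧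
    IsOmegaPsh ψ ∧
    ∀ z : P1, ∀ τ ∈ sphere (0 : ℂ) 1, ψ (z, τ) ≤ (F (z, τ) : EReal)

/-- The weak solution on `ℙ¹ × 𝔻̄` of the homogeneous Monge-Ampère equation
`(π^* ω_FS + dd^c Φ)² = 0`, `π^* ω_FS + dd^c Φ ≥ 0`, with boundary data `F (·, τ)` for `|τ| = 1`:
the upper envelope of all competitors. (Only its values on `ℙ¹ × 𝔻̄` are meaningful.) -/
def weakSolution (F : P1 × ℂ → ℝ) (p : P1 × ℂ) : EReal :=
  ⨆ (ψ : P1 × ℂ → EReal) (_ : IsCandidate F ψ), ψ p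

/-- `π^* ω_FS + dd^c Φ = 0` on the open set `S`, in the sense of currents: in each chart the function
`u = log (1 + |ζ|²) + Φ` is (almost everywhere finite and) locally integrable, and the distribution
`dd^c u` vanishes. A test form of bidegree `(1,1)` is a combination of a smooth compactly
supported function `χ` times constant forms, so that `⟨dd^c u, ·⟩` is given by the numbers
`∫ u · ddc χ · b`, for all `χ` and all directions `b`. -/
def CurrentVanishesOn (Φ : P1 × ℂ → EReal) (S : Set (P1 × ℂ)) : Prop :=
  ∀ κ ∈ charts,
    (∀ᵐ q : ℂ × ℂ, (κ q.1, q.2) ∈ S → Φ (κ q.1, q.2) ≠ ⊤ ∧ Φ (κ q.1, q.2) ≠ ⊥) ∧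
    LocallyIntegrableOn (fun q : ℂ × ℂ => fsPotential q.1 + (Φ (κ q.1, q.2)).toReal)
      {q : ℂ × ℂ | (κ q.1, q.2) ∈ S} ∧
    ∀ χ : ℂ × ℂ → ℝ, ContDiff ℝ ∞ χ → HasCompactSupport χ →
      tsupport χ ⊆ {q : ℂ × ℂ | (κ q.1, q.2) ∈ S} →
      ∀ b : ℂ × ℂ,
        ∫ q : ℂ × ℂ, (fsPotential q.1 + (Φ (κ q.1, q.2)).toReal) * ddc χ q b = 0

/-- The current `ω_FS + dd^c h` on `ℙ¹` is strictly positive: `ω_FS + dd^c h ≥ ε ω_FS` for some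
`ε > 0`, tested in each chart against smooth compactly supported functions `χ ≥ 0`. -/
def StrictlyPositive (h : P1 → EReal) : Prop :=
  ∃ ε : ℝ, 0 < ε ∧ ∀ κ ∈ charts, ∀ χ : ℂ → ℝ, ContDiff ℝ ∞ χ → HasCompactSupport χ →
    (∀ ζ, 0 ≤ χ ζ) →
      0 ≤ ∫ ζ : ℂ, ((1 - ε) * fsPotential ζ + (h (κ ζ)).toReal) * ddc χ ζ 1

/-- `π^* ω_FS + dd^c Φ` has maximal rank in the fibre directions: the current
`ω_FS + dd^c Φ (·, τ)` is strictly positive for every `τ ∈ 𝔻̄`. -/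
def HasMaximalRank (Φ : P1 × ℂ → EReal) : Prop :=
  ∀ τ ∈ closedBall (0 : ℂ) 1, StrictlyPositive (fun z => Φ (z, τ))

end HMAE

end

/-!
In the coordinate `w`, the competitor `-log (1 + |w|²) = log (|z|² / (1 + |z|²))`, with its pole at
`z = 0`, is a lower bound for `Φ`. It is also an upper bound near `(w, τ) = (0, 0)`, that is,
`U = log (1 + |w|²) + ψ` is `≤ 0` there, uniformly in the competitor `ψ`, for the following reason.

Let `K` be the set where `φ = -log (1 + |w|²)`. For `a ∈ K` one has `U ≤ 0` on the boundary of the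
disc `τ ↦ (τ a, τ)`, hence on all of it. So for `ε > 0`, in the coordinates `(v, τ)` with `w = τ v`,
the set `{U ≥ ε}` avoids `K × 𝔻̄`. Having positive capacity, `K` carries a probability measure `μ`
with `∫ log |v - x| dμ(x) ≥ m` for all `v ∉ K`. Comparing `-log |τ|` on `{U ≥ ε}` with this
potential by the maximum principle for `U` on graphs `v ↦ (v T(v), T(v))` gives
`-log |τ| ≤ ∫ log |v - x| dμ(x) - m ≤ log (|v| + R) - m`, where `R = max_K |x|`. Hence
`exp m ≤ |w| + R |τ|` on `{U ≥ ε}`.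
-/

section Penalization

variable {E : Type*} [NormedAddCommGroup E] {u : E → EReal} {Ω : Set E} {f : ℂ → E}

/-- The penalisation `u (f ζ + e) - N ‖e‖² + η ‖ζ - c‖²` of `u` near the disc `f`, as a function of
`(ζ, e)`. Its maximum principle, as `N → ∞` and `η → 0`, becomes that of `u ∘ f`. -/
noncomputable def discPenalization (u : E → EReal) (f : ℂ → E) (c : ℂ) (N η : ℝ)
    (q : ℂ × E) : EReal :=
  u (f q.1 + q.2) + ((η * ‖q.1 - c‖ ^ 2 - N * ‖q.2‖ ^ 2 : ℝ) : EReal)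

lemma exists_discPenalization_le_on_boundary {c : ℂ} {r δ : ℝ} (hδ : 0 < δ) {B m M : ℝ} (hm : m < M)
    (hB : ∀ ζ ∈ closedBall c r, ∀ e ∈ closedBall 0 δ, u (f ζ + e) ≤ B)
    (hS : ∀ ζ ∈ sphere c r, ∀ e ∈ closedBall 0 δ, u (f ζ + e) ≤ m) :
    ∃ N ≥ 0, ∃ η > 0, ∀ ζ ∈ closedBall c r, ∀ e ∈ closedBall 0 δ,
      (ζ ∈ sphere c r ∨ e ∈ sphere 0 δ) → discPenalization u f c N η (ζ, e) ≤ M := by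
  obtain ⟨η, hη, hηr⟩ : ∃ η > 0, η * r ^ 2 ≤ M - m := by
    refine ⟨(M - m) / (r ^ 2 + 1), div_pos (sub_pos.2 hm) (by positivity), ?_⟩
    rw [div_mul_eq_mul_div, div_le_iff₀ (by positivity)]
    nlinarith
  obtain ⟨N, hN, hNB⟩ : ∃ N ≥ 0, B - m ≤ N * δ ^ 2 :=
    ⟨|B - m| / δ ^ 2, by positivity, by
      rw [div_mul_cancel₀ _ (by positivity)]; exact le_abs_self _⟩
  refine ⟨N, hN, η, hη, fun ζ hζ e he hbdry => ?_⟩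
  have hη' : η * ‖ζ - c‖ ^ 2 ≤ M - m :=
    (mul_le_mul_of_nonneg_left (pow_le_pow_left₀ (norm_nonneg _)
      (mem_closedBall_iff_norm.1 hζ) 2) hη.le).trans hηr
  have hadd {A : ℝ} (hA : u (f ζ + e) ≤ A)
      (hle : A + (η * ‖ζ - c‖ ^ 2 - N * ‖e‖ ^ 2) ≤ M) : discPenalization u f c N η (ζ, e) ≤ M :=
    (add_le_add_left hA _).trans (by exact_mod_cast hle)
  rcases hbdry with hζ' | he'
  · exact hadd (hS ζ hζ' e he) (by linarith [mul_nonneg hN (sq_nonneg ‖e‖)])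
  · exact hadd (hB ζ hζ e he) (by rw [mem_sphere_zero_iff_norm.1 he']; linarith)

lemma exists_forall_norm_le_mem_and_lt (hΩ : IsOpen Ω) (husc : UpperSemicontinuousOn u Ω)
    {c : ℂ} {r : ℝ} (hf : ∀ ζ ∈ closedBall c r, ContinuousAt f ζ)
    (hmaps : MapsTo f (closedBall c r) Ω)
    {M : EReal} (hM : ∀ ζ ∈ sphere c r, u (f ζ) < M) :
    ∃ δ > 0, ∀ e ∈ closedBall (0 : E) δ, (∀ ζ ∈ closedBall c r, f ζ + e ∈ Ω) ∧
      ∀ ζ ∈ sphere c r, u (f ζ + e) < M := by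
  have hcont : ∀ ζ ∈ closedBall c r,
      Tendsto (fun q : E × ℂ => f q.2 + q.1) (𝓝 (0, ζ)) (𝓝 (f ζ)) := fun ζ hζ => by
    have : ContinuousAt (fun q : E × ℂ => f q.2 + q.1) (0, ζ) :=
      ((hf ζ hζ).comp' (x := ((0 : E), ζ)) continuousAt_snd).add continuousAt_fst
    simpa [ContinuousAt] using this
  refine Metric.nhds_basis_closedBall.eventually_iff.1 (.and ?_ ?_)
  · exact (isCompact_closedBall c r).eventually_forall_of_forall_eventually fun ζ hζ =>
      (hcont ζ hζ).eventually (hΩ.mem_nhds (hmaps hζ))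
  · refine (isCompact_sphere c r).eventually_forall_of_forall_eventually fun ζ hζ => ?_
    have hζ' := sphere_subset_closedBall hζ
    have := husc _ (hmaps hζ') M (hM ζ hζ)
    rw [hΩ.nhdsWithin_eq (hmaps hζ')] at this
    exact (hcont ζ hζ').eventually this

end Penalization

namespace PlurisubharmonicOn

section NormedSpace

variable {E F : Type*} [NormedAddCommGroup E] [NormedSpace ℂ E] [NormedAddCommGroup F]
  [NormedSpace ℂ F] {u : E → EReal} {Ω : Set E}

lemma comp_continuousLinearMap (hu : PlurisubharmonicOn u Ω) (L : F →L[ℂ] E) :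
    PlurisubharmonicOn (u ∘ L) (L ⁻¹' Ω) := by
  refine ⟨hu.1.comp L.continuous.continuousOn (mapsTo_preimage L Ω), fun p hp => hu.2.1 _ hp,
    fun a b hab g hg hle => hu.2.2 (L a) (L b) (fun ζ hζ => ?_) g hg fun ζ hζ => ?_⟩
  · simpa using hab ζ hζ
  · simpa using hle ζ hζ

lemma le_re_of_le_re_on_sphere (hu : PlurisubharmonicOn u Ω) {a b : E}
    (hab : ∀ ζ ∈ closedBall (0 : ℂ) 1, a + ζ • b ∈ Ω) {h : ℂ → ℂ}
    (hh : AnalyticOnNhd ℂ h (closedBall 0 1))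
    (hle : ∀ ζ ∈ sphere (0 : ℂ) 1, u (a + ζ • b) ≤ ((h ζ).re : ℝ)) : u a ≤ ((h 0).re : ℝ) := by
  have hmean : Real.circleAverage (fun ζ => (h ζ).re) 0 1 = (h 0).re :=
    InnerProductSpace.HarmonicOnNhd.circleAverage_eq fun ζ hζ =>
      (hh ζ (by simpa using hζ)).harmonicAt_re
  rw [← hmean]
  exact hu.2.2 a b hab _ (Complex.continuous_re.comp_continuousOn
    (hh.continuousOn.mono sphere_subset_closedBall)) hle

lemma lt_of_eventually_le_re_sub (hu : PlurisubharmonicOn u Ω) {p b : E} (hΩ : Ω ∈ 𝓝 p)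
    {h : ℂ → ℂ} (hh : AnalyticAt ℂ h 0) {ε : ℝ} (hε : 0 < ε)
    (hle : ∀ᶠ t in 𝓝 (0 : ℂ), u (p + t • b) ≤ (((h t).re - ε * ‖t‖ ^ 2 : ℝ) : EReal)) :
    u p < ((h 0).re : ℝ) := by
  have hline : Tendsto (fun t : ℂ => p + t • b) (𝓝 0) (𝓝 p) :=
    Continuous.tendsto' (by fun_prop) _ _ (by simp)
  obtain ⟨s, hs, hball⟩ := Metric.nhds_basis_closedBall.eventually_iff.1
    (hle.and (hh.eventually_analyticAt.and (hline hΩ)))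
  have hsmul : ∀ ζ ∈ closedBall (0 : ℂ) 1, (s : ℂ) * ζ ∈ closedBall 0 s := fun ζ hζ => by
    rw [mem_closedBall_zero_iff] at hζ ⊢
    rw [norm_mul, Complex.norm_of_nonneg hs.le]
    exact mul_le_of_le_one_right hs.le hζ
  have hscale (ζ : ℂ) : p + ζ • (s : ℂ) • b = p + ((s : ℂ) * ζ) • b := by
    rw [smul_smul, mul_comm]
  have hbound : u p ≤ ((h (s * 0) - (ε * s ^ 2 : ℝ)).re : ℝ) := by
    refine hu.le_re_of_le_re_on_sphere (b := (s : ℂ) • b)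
      (h := fun ζ => h (s * ζ) - (ε * s ^ 2 : ℝ))
      (fun ζ hζ => hscale ζ ▸ (hball (hsmul ζ hζ)).2.2) (fun ζ hζ => ?_) fun ζ hζ => ?_
    · exact ((hball (hsmul ζ hζ)).2.1.fun_comp (by fun_prop)).sub analyticAt_const
    · have := (hball (hsmul ζ (sphere_subset_closedBall hζ))).1
      rw [norm_mul, Complex.norm_of_nonneg hs.le, mem_sphere_zero_iff_norm.1 hζ, mul_one] at this
      rwa [hscale, Complex.sub_re, Complex.ofReal_re]
  refine hbound.trans_lt (EReal.coe_lt_coe_iff.2 ?_)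
  rw [mul_zero, Complex.sub_re, Complex.ofReal_re]
  exact sub_lt_self _ (by positivity)

lemma upperSemicontinuousOn_discPenalization (hu : PlurisubharmonicOn u Ω) {f : ℂ → E} {c : ℂ}
    {X : Set (ℂ × E)} (hf : ContinuousOn (fun q : ℂ × E => f q.1) X)
    (hmaps : ∀ q ∈ X, f q.1 + q.2 ∈ Ω) (N η : ℝ) :
    UpperSemicontinuousOn (discPenalization u f c N η) X := by
  refine UpperSemicontinuousOn.add' (hu.1.comp (hf.add continuousOn_snd) hmaps)
    (continuous_coe_real_ereal.comp_continuousOn (by fun_prop)).upperSemicontinuousOn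
    fun q hq => ?_
  exact EReal.continuousAt_add (.inl (hu.2.1 _ (hmaps q hq))) (.inr (EReal.coe_ne_top _))

end NormedSpace

section InnerProductSpace

variable {E : Type*} [NormedAddCommGroup E] [InnerProductSpace ℂ E] {u : E → EReal} {Ω : Set E}
  {f : ℂ → E}

/-- Put `p = f ζ + e`. Along the line through `f ζ₀ + e₀` tangent to the disc `f` one has
`ζ = ζ₀ + t` and `e = e₀ - o(t)`, so that `N ‖e‖² - η ‖ζ - c‖²` is the real part of a holomorphic
function of `t` minus `η |t|² - o(|t|²)`. -/
lemma lt_of_eventually_le [CompleteSpace E] (hu : PlurisubharmonicOn u Ω) {ζ₀ c : ℂ} {e₀ : E}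
    (hf : AnalyticAt ℂ f ζ₀) (hΩ : Ω ∈ 𝓝 (f ζ₀ + e₀)) {C N η : ℝ} (hN : 0 ≤ N) (hη : 0 < η)
    (hle : ∀ᶠ q : ℂ × E in 𝓝 (ζ₀, e₀),
      u (f q.1 + q.2) ≤ ((C + N * ‖q.2‖ ^ 2 - η * ‖q.1 - c‖ ^ 2 : ℝ) : EReal)) :
    u (f ζ₀ + e₀) < ((C + N * ‖e₀‖ ^ 2 - η * ‖ζ₀ - c‖ ^ 2 : ℝ) : EReal) := by
  obtain ⟨κ, hκ, hκη⟩ : ∃ κ : ℝ, 0 < κ ∧ N * κ ^ 2 < η := by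
    refine ⟨√(η / (N + 1)), by positivity, ?_⟩
    rw [Real.sq_sqrt (by positivity), mul_div_assoc', div_lt_iff₀ (by positivity)]
    nlinarith
  let q : ℂ → E := fun t => f (ζ₀ + t) - f ζ₀ - t • deriv f ζ₀
  have hq : ∀ᶠ t in 𝓝 0, ‖q t‖ ≤ κ * ‖t‖ :=
    (hasDerivAt_iff_isLittleO_nhds_zero.1 hf.differentiableAt.hasDerivAt).bound hκ
  have hq0 : q 0 = 0 := by simp [q]
  have hqa : AnalyticAt ℂ q 0 := by
    have hfs : AnalyticAt ℂ (fun t => f (ζ₀ + t)) 0 :=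
      AnalyticAt.fun_comp (by rwa [add_zero]) (by fun_prop)
    exact (hfs.sub analyticAt_const).sub (by fun_prop)
  have hframe : Tendsto (fun t => (ζ₀ + t, e₀ - q t)) (𝓝 0) (𝓝 (ζ₀, e₀)) := by
    have : ContinuousAt (fun t => (ζ₀ + t, e₀ - q t)) 0 :=
      (by fun_prop : ContinuousAt (fun t : ℂ => ζ₀ + t) 0).prodMk
        (continuousAt_const.sub hqa.continuousAt)
    simpa [ContinuousAt, hq0] using this
  let h : ℂ → ℂ := fun t => ((C + N * ‖e₀‖ ^ 2 - η * ‖ζ₀ - c‖ ^ 2 : ℝ) : ℂ) -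
    (2 * N : ℝ) * inner ℂ e₀ (q t) - (2 * η : ℝ) * inner ℂ (ζ₀ - c) t
  have hh : AnalyticAt ℂ h 0 :=
    (analyticAt_const.sub (analyticAt_const.mul
      (((innerSL ℂ e₀).analyticAt _).fun_comp hqa))).sub
        (analyticAt_const.mul ((innerSL ℂ (ζ₀ - c)).analyticAt 0))
  have hh0 : (h 0).re = C + N * ‖e₀‖ ^ 2 - η * ‖ζ₀ - c‖ ^ 2 := by
    simp only [h, hq0, inner_zero_right, mul_zero, sub_zero, Complex.ofReal_re]
  rw [← hh0]
  refine hu.lt_of_eventually_le_re_sub hΩ (b := deriv f ζ₀) hh (sub_pos.2 hκη) ?_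
  filter_upwards [hframe.eventually hle, hq] with t ht hqt
  have hpoint : f ζ₀ + e₀ + t • deriv f ζ₀ = f (ζ₀ + t) + (e₀ - q t) := by
    simp only [q]; abel
  rw [hpoint]
  refine ht.trans (EReal.coe_le_coe_iff.2 ?_)
  have hqt2 : N * ‖q t‖ ^ 2 ≤ N * (κ * ‖t‖) ^ 2 := by gcongr
  simp only [h, Complex.sub_re, Complex.re_ofReal_mul, Complex.ofReal_re]
  rw [add_sub_right_comm ζ₀, norm_sub_sq (𝕜 := ℂ) e₀, norm_add_sq (𝕜 := ℂ) (ζ₀ - c)]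
  simp only [RCLike.re_eq_complex_re]
  linarith

lemma not_isLocalMax_discPenalization [CompleteSpace E] (hu : PlurisubharmonicOn u Ω) {c : ℂ}
    {q : ℂ × E} (hf : AnalyticAt ℂ f q.1) (hΩ : Ω ∈ 𝓝 (f q.1 + q.2)) {N η : ℝ} (hN : 0 ≤ N)
    (hη : 0 < η) (hbot : discPenalization u f c N η q ≠ ⊥) :
    ¬ IsLocalMax (discPenalization u f c N η) q := by
  intro hmax
  have htop : discPenalization u f c N η q ≠ ⊤ :=
    EReal.add_ne_top (hu.2.1 _ (mem_of_mem_nhds hΩ)) (EReal.coe_ne_top _)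
  lift discPenalization u f c N η q to ℝ using ⟨htop, hbot⟩ with C hC
  have hiff (p : ℂ × E) (A : ℝ) : discPenalization u f c N η p ≤ (A : EReal) ↔
      u (f p.1 + p.2) ≤ ((A + N * ‖p.2‖ ^ 2 - η * ‖p.1 - c‖ ^ 2 : ℝ) : EReal) := by
    rw [discPenalization, ← EReal.le_sub_iff_add_le (.inl (EReal.coe_ne_bot _))
      (.inl (EReal.coe_ne_top _)), ← EReal.coe_sub]
    ring_nf
  have hlt := hu.lt_of_eventually_le (c := c) (C := C) hf hΩ hN hη <| by
    filter_upwards [hmax] with p hp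
    exact (hiff p C).1 (by rwa [hC])
  obtain ⟨A, hA, hAC⟩ := EReal.lt_iff_exists_real_btwn.1 hlt
  have := (hiff q (A - N * ‖q.2‖ ^ 2 + η * ‖q.1 - c‖ ^ 2)).2 (by convert hA.le using 2; ring)
  rw [← hC, EReal.coe_le_coe_iff] at this
  rw [EReal.coe_lt_coe_iff] at hAC
  linarith

lemma le_on_disc_of_innerProductSpace [ProperSpace E] (hu : PlurisubharmonicOn u Ω)
    (hΩ : IsOpen Ω) {c : ℂ} {r : ℝ} (hf : AnalyticOnNhd ℂ f (closedBall c r))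
    (hmaps : MapsTo f (closedBall c r) Ω) {M : ℝ} (hM : ∀ ζ ∈ sphere c r, u (f ζ) ≤ M) :
    ∀ ζ ∈ closedBall c r, u (f ζ) ≤ M := by
  intro ζ₁ hζ₁
  by_contra! hlt
  obtain ⟨M', hMM', hM'⟩ := EReal.lt_iff_exists_real_btwn.1 hlt
  obtain ⟨m, hMm, hmM'⟩ := exists_between (EReal.coe_lt_coe_iff.1 hMM')
  obtain ⟨δ, hδ, hnear⟩ := exists_forall_norm_le_mem_and_lt hΩ hu.1 (M := m)
    (fun ζ hζ => (hf ζ hζ).continuousAt) hmaps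
    fun ζ hζ => (hM ζ hζ).trans_lt (EReal.coe_lt_coe_iff.2 hMm)
  set X := closedBall c r ×ˢ closedBall (0 : E) δ
  have hX : IsCompact X := (isCompact_closedBall c r).prod (isCompact_closedBall 0 δ)
  have hfX : ContinuousOn (fun q : ℂ × E => f q.1) X :=
    hf.continuousOn.comp continuousOn_fst fun q hq => hq.1
  have hXΩ : ∀ q ∈ X, f q.1 + q.2 ∈ Ω := fun q hq => (hnear q.2 hq.2).1 q.1 hq.1
  have hζ₁X : (ζ₁, (0 : E)) ∈ X := ⟨hζ₁, mem_closedBall_self hδ.le⟩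
  obtain ⟨B, hB⟩ : ∃ B : ℝ, ∀ q ∈ X, u (f q.1 + q.2) ≤ B := by
    obtain ⟨q, hq, hmax⟩ := UpperSemicontinuousOn.exists_isMaxOn ⟨_, hζ₁X⟩ hX
      (hu.1.comp (hfX.add continuousOn_snd) hXΩ)
    obtain ⟨B, hB, -⟩ := EReal.lt_iff_exists_real_btwn.1 (hu.2.1 _ (hXΩ q hq)).lt_top
    exact ⟨B, fun p hp => (hmax hp).trans hB.le⟩
  obtain ⟨N, hN, η, hη, hbdry⟩ := exists_discPenalization_le_on_boundary hδ hmM'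
    (fun ζ hζ e he => hB (ζ, e) ⟨hζ, he⟩) (fun ζ hζ e he => ((hnear e he).2 ζ hζ).le)
  obtain ⟨q, hq, hmax⟩ := UpperSemicontinuousOn.exists_isMaxOn ⟨_, hζ₁X⟩ hX
    (upperSemicontinuousOn_discPenalization (c := c) hu hfX hXΩ N η)
  have hM'q : (M' : EReal) < discPenalization u f c N η q := by
    refine lt_of_lt_of_le ?_ (hmax hζ₁X)
    simp only [discPenalization, add_zero, norm_zero, zero_pow two_ne_zero, mul_zero, sub_zero]
    exact hM'.trans_le (le_add_of_nonneg_right (EReal.coe_nonneg.2 (by positivity)))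
  have hq1 : q.1 ∈ ball c r := (mem_closedBall.1 hq.1).lt_of_ne fun h =>
    hM'q.not_ge (hbdry q.1 hq.1 q.2 hq.2 (.inl h))
  have hq2 : q.2 ∈ ball (0 : E) δ := (mem_closedBall.1 hq.2).lt_of_ne fun h =>
    hM'q.not_ge (hbdry q.1 hq.1 q.2 hq.2 (.inr h))
  exact hu.not_isLocalMax_discPenalization (hf q.1 hq.1) (hΩ.mem_nhds (hXΩ q hq)) hN hη hM'q.ne_bot
    (hmax.isLocalMax (prod_mem_nhds (closedBall_mem_nhds_of_mem hq1)
      (closedBall_mem_nhds_of_mem hq2)))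

end InnerProductSpace

section FiniteDimensional

variable {E : Type*} [NormedAddCommGroup E] [NormedSpace ℂ E] [FiniteDimensional ℂ E]
  {u : E → EReal} {Ω : Set E} {f : ℂ → E} {c : ℂ} {r : ℝ}

lemma le_on_disc (hu : PlurisubharmonicOn u Ω) (hΩ : IsOpen Ω)
    (hf : AnalyticOnNhd ℂ f (closedBall c r)) (hmaps : MapsTo f (closedBall c r) Ω) {M : ℝ}
    (hM : ∀ ζ ∈ sphere c r, u (f ζ) ≤ M) : ∀ ζ ∈ closedBall c r, u (f ζ) ≤ M := by
  let L : EuclideanSpace ℂ (Fin (Module.finrank ℂ E)) ≃L[ℂ] E :=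
    ContinuousLinearEquiv.ofFinrankEq finrank_euclideanSpace_fin
  have hL := (hu.comp_continuousLinearMap (L : _ →L[ℂ] E)).le_on_disc_of_innerProductSpace
    (hΩ.preimage L.continuous) (f := L.symm ∘ f) (c := c) (r := r) (M := M)
    (fun ζ hζ => (L.symm.toContinuousLinearMap.analyticAt _).comp (hf ζ hζ))
    (fun ζ hζ => by simpa using hmaps hζ) (fun ζ hζ => by simpa using hM ζ hζ)
  exact fun ζ hζ => by simpa using hL ζ hζ

lemma lt_on_disc (hu : PlurisubharmonicOn u Ω) (hΩ : IsOpen Ω) (hr : 0 ≤ r)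
    (hf : AnalyticOnNhd ℂ f (closedBall c r)) (hmaps : MapsTo f (closedBall c r) Ω) {M : ℝ}
    (hM : ∀ ζ ∈ sphere c r, u (f ζ) < M) : ∀ ζ ∈ closedBall c r, u (f ζ) < M := by
  obtain ⟨ζ₀, hζ₀, hmax⟩ := UpperSemicontinuousOn.exists_isMaxOn
    (NormedSpace.sphere_nonempty.2 hr) (isCompact_sphere c r)
    (hu.1.comp (hf.continuousOn.mono sphere_subset_closedBall)
      (hmaps.mono_left sphere_subset_closedBall))
  obtain ⟨M', hM', hM'M⟩ := EReal.lt_iff_exists_real_btwn.1 (hM ζ₀ hζ₀)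
  exact fun ζ hζ => (hu.le_on_disc hΩ hf hmaps (fun ξ hξ => (hmax hξ).trans hM'.le) ζ hζ).trans_lt
    hM'M

/-- Upper semicontinuity up to the boundary of the disc replaces analyticity there: if the
superlevel set `{u ∘ f ≥ M'}` were non-empty, the strict maximum principle would fail on a circle
just beyond its furthest point from the centre. -/
lemma le_on_disc_of_boundary {Ω' : Set E} (hu : PlurisubharmonicOn u Ω) (hΩ : IsOpen Ω)
    (husc : UpperSemicontinuousOn u Ω') (hfc : ContinuousOn f (closedBall c r))
    (hf : AnalyticOnNhd ℂ f (ball c r)) (hmaps : MapsTo f (ball c r) Ω)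
    (hmaps' : MapsTo f (closedBall c r) Ω') {M : ℝ} (hM : ∀ ζ ∈ sphere c r, u (f ζ) ≤ M) :
    ∀ ζ ∈ closedBall c r, u (f ζ) ≤ M := by
  intro ζ₁ hζ₁
  by_contra! hlt
  obtain ⟨M', hMM', hM'⟩ := EReal.lt_iff_exists_real_btwn.1 hlt
  set K := closedBall c r ∩ (u ∘ f) ⁻¹' Ici (M' : EReal)
  have hK : IsCompact K :=
    (husc.comp hfc hmaps').isCompact_inter_preimage_Ici (isCompact_closedBall c r) _
  obtain ⟨ζ₀, ⟨hζ₀, hζ₀M⟩, hmax⟩ := hK.exists_isMaxOn ⟨ζ₁, hζ₁, hM'.le⟩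
    (continuous_id.dist continuous_const : Continuous fun ζ => dist ζ c).continuousOn
  have hζ₀r : dist ζ₀ c < r := (mem_closedBall.1 hζ₀).lt_of_ne fun h =>
    (hM ζ₀ h).not_gt (hMM'.trans_le hζ₀M)
  obtain ⟨s, hs, hsr⟩ := exists_between hζ₀r
  have hsub : closedBall c s ⊆ ball c r := closedBall_subset_ball hsr
  have hlt := hu.lt_on_disc hΩ (dist_nonneg.trans hs.le) (hf.mono hsub) (hmaps.mono_left hsub)
    (M := M') (fun ζ hζ => ?_) ζ₀ (mem_closedBall.2 hs.le)
  · exact hlt.not_ge hζ₀M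
  · by_contra! hle
    have hζK : ζ ∈ K := ⟨ball_subset_closedBall (hsub (sphere_subset_closedBall hζ)), hle⟩
    exact (hs.trans_eq (mem_sphere.1 hζ).symm).not_ge (hmax hζK)

end FiniteDimensional

end PlurisubharmonicOn

/-- The logarithmic potential of `μ` at `v`. It is only meaningful where `x ↦ log ‖v - x‖` is
`μ`-integrable, in particular off any compact set carrying `μ`. -/
noncomputable def logPotential (μ : Measure ℂ) (v : ℂ) : ℝ := ∫ x, Real.log ‖v - x‖ ∂μ

/-- `K` has positive logarithmic capacity: it carries a probability measure whose logarithmic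
potential is bounded below. The bound is only asked off `K`, where the potential of a measure on
the compact set `K` is a convergent integral. -/
def HasPositiveCapacity (K : Set ℂ) : Prop :=
  ∃ μ : Measure ℂ, IsProbabilityMeasure μ ∧ (∀ᵐ x ∂μ, x ∈ K) ∧
    ∃ m : ℝ, ∀ v ∉ K, m ≤ logPotential μ v

section LogPotential

variable {μ : Measure ℂ} {K : Set ℂ} {v v₀ : ℂ}

lemma sub_ne_zero_of_notMem {x : ℂ} (hv : v ∉ K) (hx : x ∈ K) : v - x ≠ 0 :=
  sub_ne_zero.2 fun h => hv (h ▸ hx)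

lemma integrable_of_continuousOn {E : Type*} [NormedAddCommGroup E] [IsFiniteMeasure μ]
    {f : ℂ → E} (hK : IsCompact K) (hμ : ∀ᵐ x ∂μ, x ∈ K) (hf : ContinuousOn f K) :
    Integrable f μ := by
  have hint : IntegrableOn f K μ := hf.integrableOn_compact hK
  rwa [IntegrableOn, Measure.restrict_eq_self_of_ae_mem hμ] at hint

lemma continuousOn_log_norm_sub (hv : v ∉ K) : ContinuousOn (fun x => Real.log ‖v - x‖) K :=
  (by fun_prop : ContinuousOn (fun x => ‖v - x‖) K).log fun _ hx =>
    norm_ne_zero_iff.2 (sub_ne_zero_of_notMem hv hx)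

lemma logPotential_le [IsProbabilityMeasure μ] (hK : IsCompact K) (hμ : ∀ᵐ x ∂μ, x ∈ K) {R : ℝ}
    (hR : ∀ x ∈ K, ‖x‖ ≤ R) (hv : v ∉ K) : logPotential μ v ≤ Real.log (‖v‖ + R) := by
  have hle : logPotential μ v ≤ ∫ _, Real.log (‖v‖ + R) ∂μ := by
    refine integral_mono_ae (integrable_of_continuousOn hK hμ (continuousOn_log_norm_sub hv))
      (integrable_const _) ?_
    filter_upwards [hμ] with x hx
    exact Real.log_le_log (norm_pos_iff.2 (sub_ne_zero_of_notMem hv hx))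
      ((norm_sub_le v x).trans (by linarith [hR x hx]))
  simpa using hle

lemma le_logPotential [IsProbabilityMeasure μ] (hK : IsCompact K) (hμ : ∀ᵐ x ∂μ, x ∈ K) {R : ℝ}
    (hR : ∀ x ∈ K, ‖x‖ ≤ R) (hv : R < ‖v‖) : Real.log (‖v‖ - R) ≤ logPotential μ v := by
  have hvK : v ∉ K := fun h => (hR v h).not_gt hv
  have hle : ∫ _, Real.log (‖v‖ - R) ∂μ ≤ logPotential μ v := by
    refine integral_mono_ae (integrable_const _)
      (integrable_of_continuousOn hK hμ (continuousOn_log_norm_sub hvK)) ?_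
    filter_upwards [hμ] with x hx
    exact Real.log_le_log (sub_pos.2 hv)
      (le_trans (by linarith [hR x hx]) (norm_sub_norm_le v x))
  simpa using hle

lemma le_norm_sub_of_ball_subset_compl {x : ℂ} {r : ℝ} (h : ball v r ⊆ Kᶜ) (hx : x ∈ K) :
    r ≤ ‖v - x‖ := by
  rw [← dist_eq_norm, dist_comm]
  exact not_lt.1 fun hlt => h hlt hx

lemma div_mem_slitPlane {x : ℂ} (h : ‖v - v₀‖ < ‖v₀ - x‖) :
    (v - x) / (v₀ - x) ∈ Complex.slitPlane := by
  have hpos : 0 < ‖v₀ - x‖ := (norm_nonneg _).trans_lt h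
  have hdecomp : (v - x) / (v₀ - x) = 1 + (v - v₀) / (v₀ - x) := by
    have := norm_pos_iff.1 hpos
    field_simp
    ring
  rw [hdecomp]
  exact Complex.mem_slitPlane_of_norm_lt_one (by rwa [norm_div, div_lt_one hpos])

lemma analyticAt_integral_log_div [IsFiniteMeasure μ] (hK : IsCompact K)
    (hμ : ∀ᵐ x ∂μ, x ∈ K) (hv₀ : v₀ ∉ K) :
    AnalyticAt ℂ (fun v => ∫ x, Complex.log ((v - x) / (v₀ - x)) ∂μ) v₀ := by
  obtain ⟨r, hr, hball⟩ := Metric.isOpen_iff.1 hK.isClosed.isOpen_compl v₀ hv₀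
  have hfar : ∀ v ∈ ball v₀ (r / 2), ∀ x ∈ K, r / 2 ≤ ‖v - x‖ := fun v hv x hx =>
    le_norm_sub_of_ball_subset_compl ((ball_subset_ball' (by linarith [mem_ball.1 hv])).trans hball)
      hx
  have hslit : ∀ v ∈ ball v₀ (r / 2), ∀ x ∈ K, (v - x) / (v₀ - x) ∈ Complex.slitPlane :=
    fun v hv x hx => div_mem_slitPlane <|
      ((mem_ball_iff_norm.1 hv).trans (half_lt_self hr)).trans_le
        (le_norm_sub_of_ball_subset_compl hball hx)
  have hne : ∀ v ∈ ball v₀ (r / 2), ∀ x ∈ K, v - x ≠ 0 := fun v hv x hx =>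
    norm_pos_iff.1 ((half_pos hr).trans_le (hfar v hv x hx))
  have hmem := mem_ball_self (x := v₀) (half_pos hr)
  have hcont : ∀ v ∈ ball v₀ (r / 2),
      ContinuousOn (fun x => Complex.log ((v - x) / (v₀ - x))) K := fun v hv =>
    ((by fun_prop : ContinuousOn (fun x => v - x) K).div (by fun_prop) (hne v₀ hmem)).clog
      (hslit v hv)
  refine DifferentiableOn.analyticAt (s := ball v₀ (r / 2)) (fun v hv => ?_)
    (ball_mem_nhds v₀ (half_pos hr))
  refine ((hasDerivAt_integral_of_dominated_loc_of_deriv_le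
    (F' := fun v x => (v - x)⁻¹) (bound := fun _ => (r / 2)⁻¹) (isOpen_ball.mem_nhds hv)
    ?_ (integrable_of_continuousOn hK hμ (hcont v hv)) ?_ ?_ (integrable_const _) ?_).2
    ).differentiableAt.differentiableWithinAt
  · filter_upwards [isOpen_ball.mem_nhds hv] with v' hv'
    exact (integrable_of_continuousOn hK hμ (hcont v' hv')).aestronglyMeasurable
  · have hinv : ContinuousOn (fun x => (v - x)⁻¹) K :=
      (by fun_prop : ContinuousOn (fun x => v - x) K).inv₀ (hne v hv)
    exact (integrable_of_continuousOn hK hμ hinv).aestronglyMeasurable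
  · filter_upwards [hμ] with x hx v' hv'
    rw [norm_inv]
    exact inv_anti₀ (half_pos hr) (hfar v' hv' x hx)
  · filter_upwards [hμ] with x hx v' hv'
    have hderiv := (((hasDerivAt_id v').sub_const x).div_const (v₀ - x)).clog (hslit v' hv' x hx)
    rwa [id_eq, div_div_div_cancel_right₀ (hne v₀ hmem x hx), one_div] at hderiv

lemma re_integral_log_div [IsFiniteMeasure μ] (hK : IsCompact K) (hμ : ∀ᵐ x ∂μ, x ∈ K)
    (hv₀ : v₀ ∉ K) (hv : v ∉ K) (hslit : ∀ x ∈ K, (v - x) / (v₀ - x) ∈ Complex.slitPlane) :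
    (∫ x, Complex.log ((v - x) / (v₀ - x)) ∂μ).re = logPotential μ v - logPotential μ v₀ := by
  have hcont : ContinuousOn (fun x => Complex.log ((v - x) / (v₀ - x))) K :=
    ((by fun_prop : ContinuousOn (fun x => v - x) K).div (by fun_prop) fun x =>
      sub_ne_zero_of_notMem hv₀).clog hslit
  rw [logPotential, logPotential,
    ← integral_sub (integrable_of_continuousOn hK hμ (continuousOn_log_norm_sub hv))
      (integrable_of_continuousOn hK hμ (continuousOn_log_norm_sub hv₀)),
    ← RCLike.re_eq_complex_re, ← integral_re (integrable_of_continuousOn hK hμ hcont)]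
  refine integral_congr_ae ?_
  filter_upwards [hμ] with x hx
  rw [RCLike.re_eq_complex_re, Complex.log_re, norm_div,
    Real.log_div (norm_ne_zero_iff.2 (sub_ne_zero_of_notMem hv hx))
      (norm_ne_zero_iff.2 (sub_ne_zero_of_notMem hv₀ hx))]

lemma harmonicAt_logPotential [IsFiniteMeasure μ] (hK : IsCompact K) (hμ : ∀ᵐ x ∂μ, x ∈ K)
    (hv₀ : v₀ ∉ K) : InnerProductSpace.HarmonicAt (logPotential μ) v₀ := by
  have hF := (analyticAt_integral_log_div hK hμ hv₀).add
    (analyticAt_const (v := (logPotential μ v₀ : ℂ)))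
  refine (InnerProductSpace.harmonicAt_congr_nhds ?_).1 hF.harmonicAt_re
  obtain ⟨r, hr, hball⟩ := Metric.isOpen_iff.1 hK.isClosed.isOpen_compl v₀ hv₀
  filter_upwards [ball_mem_nhds v₀ hr] with v hv
  have hslit : ∀ x ∈ K, (v - x) / (v₀ - x) ∈ Complex.slitPlane := fun x hx =>
    div_mem_slitPlane <| (mem_ball_iff_norm.1 hv).trans_le
      (le_norm_sub_of_ball_subset_compl hball hx)
  simp [re_integral_log_div hK hμ hv₀ (hball hv) hslit]

end LogPotential

section Arc

lemma neg_two_le_integral_log_abs_sub {a b c : ℝ} (hac : a ≤ c) (hcb : c ≤ b) :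
    -2 ≤ ∫ t in a..b, Real.log |t - c| := by
  have hmul_log : ∀ x : ℝ, 0 ≤ x → -1 ≤ x * Real.log x - x := by
    intro x hx
    rcases hx.eq_or_lt with rfl | hx
    · norm_num
    · have := mul_le_mul_of_nonneg_left (Real.one_sub_inv_le_log_of_pos hx) hx.le
      rw [mul_sub, mul_inv_cancel₀ hx.ne'] at this
      linarith
  simp only [Real.log_abs]
  rw [intervalIntegral.integral_comp_sub_right Real.log c, integral_log,
    ← Real.log_neg_eq_log (a - c), neg_sub]
  linarith [hmul_log (b - c) (by linarith), hmul_log (c - a) (by linarith)]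

lemma integral_unitInterval {E : Type*} [NormedAddCommGroup E] [NormedSpace ℝ E] (f : ℝ → E) :
    ∫ t : unitInterval, f t = ∫ t in (0 : ℝ)..1, f t := by
  rw [intervalIntegral.integral_of_le zero_le_one, ← integral_Icc_eq_integral_Ioc,
    ← integral_subtype measurableSet_Icc]

lemma integrable_log_abs_sub (c : ℝ) :
    Integrable fun t : unitInterval => Real.log |(t : ℝ) - c| := by
  have hlog : IntervalIntegrable (fun t => Real.log |t - c|) volume 0 1 := by
    simpa using
      (intervalIntegral.intervalIntegrable_log' (a := 0 - c) (b := 1 - c)).comp_sub_right c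
  rw [intervalIntegrable_iff_integrableOn_Icc_of_le zero_le_one] at hlog
  exact (unitInterval.measurePreserving_coe.integrable_comp_emb
    (MeasurableEmbedding.subtype_coe measurableSet_Icc)).2 hlog

lemma le_integral_log_norm_sub_of_antilipschitz {γ : unitInterval → ℂ} {k : NNReal}
    (hγ : Continuous γ) (hanti : AntilipschitzWith k γ) {v : ℂ} (hv : v ∉ range γ) :
    -2 - Real.log (2 * k) ≤ ∫ t, Real.log ‖v - γ t‖ := by
  have hpos : ∀ t, 0 < ‖v - γ t‖ := fun t =>
    norm_pos_iff.2 (sub_ne_zero_of_notMem hv (mem_range_self t))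
  have hcont : Continuous fun t => ‖v - γ t‖ := by fun_prop
  have hint : Integrable fun t => Real.log ‖v - γ t‖ :=
    (hcont.log fun t => (hpos t).ne').integrable_of_hasCompactSupport
      (HasCompactSupport.of_compactSpace _)
  -- With `γ t₀` a point of the curve nearest to `v`, one has `|t - t₀| ≤ 2 k ‖v - γ t‖`.
  obtain ⟨t₀, -, hmin⟩ := isCompact_univ.exists_isMinOn univ_nonempty hcont.continuousOn
  have hparam : ∀ t : unitInterval, |(t : ℝ) - t₀| ≤ 2 * k * ‖v - γ t‖ := fun t => by
    have hlip := hanti.le_mul_dist t t₀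
    have htri := dist_triangle_left (γ t) (γ t₀) v
    rw [dist_eq_norm v, dist_eq_norm v] at htri
    rw [Subtype.dist_eq, Real.dist_eq] at hlip
    have := mul_le_mul_of_nonneg_left
      (htri.trans (add_le_add_right (hmin (mem_univ t)) _)) k.coe_nonneg
    linarith
  have hle : ∫ t : unitInterval, Real.log |(t : ℝ) - t₀| ≤
      ∫ t, (Real.log (2 * k) + Real.log ‖v - γ t‖) := by
    refine integral_mono_ae (integrable_log_abs_sub t₀) ((integrable_const _).add hint) ?_
    filter_upwards [Measure.ae_ne volume t₀] with t ht
    have habs : 0 < |(t : ℝ) - t₀| := abs_pos.2 (sub_ne_zero.2 (Subtype.coe_ne_coe.2 ht))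
    have hk := pos_of_mul_pos_left (habs.trans_le (hparam t)) (hpos t).le
    rw [← Real.log_mul hk.ne' (hpos t).ne']
    exact Real.log_le_log habs (hparam t)
  rw [integral_add (integrable_const _) hint, integral_const, probReal_univ,
    one_smul, integral_unitInterval fun t => Real.log |t - t₀|] at hle
  linarith [neg_two_le_integral_log_abs_sub t₀.2.1 t₀.2.2]

lemma hasPositiveCapacity_of_antilipschitz {γ : unitInterval → ℂ} {k : NNReal}
    (hγ : Continuous γ) (hanti : AntilipschitzWith k γ) {K : Set ℂ} (hK : ∀ t, γ t ∈ K) :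
    HasPositiveCapacity K := by
  have hemb := (hγ.isClosedEmbedding hanti.injective).measurableEmbedding
  refine ⟨volume.map γ, Measure.isProbabilityMeasure_map hγ.aemeasurable,
    hemb.ae_map_iff.2 (Eventually.of_forall hK), -2 - Real.log (2 * k), fun v hv => ?_⟩
  rw [logPotential, hemb.integral_map]
  exact le_integral_log_norm_sub_of_antilipschitz hγ hanti fun ⟨t, ht⟩ => hv (ht ▸ hK t)

lemma exists_deriv_ne_zero_of_injOn {E : Type*} [NormedAddCommGroup E] [NormedSpace ℝ E]
    {γ : ℝ → E} {a b : ℝ} (hab : a < b) (hγ : DifferentiableOn ℝ γ (Ioo a b))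
    (hinj : InjOn γ (Ioo a b)) : ∃ t ∈ Ioo a b, deriv γ t ≠ 0 := by
  by_contra! h
  obtain ⟨c, hac, hcb⟩ := exists_between hab
  obtain ⟨d, hcd, hdb⟩ := exists_between hcb
  have hc : c ∈ Ioo a b := ⟨hac, hcb⟩
  have hd : d ∈ Ioo a b := ⟨hac.trans hcd, hdb⟩
  exact hcd.ne (hinj hc hd (isOpen_Ioo.is_const_of_deriv_eq_zero isPreconnected_Ioo hγ h hc hd))

lemma exists_antilipschitzWith_comp_affine {E : Type*} [NormedAddCommGroup E] [NormedSpace ℝ E]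
    {γ : ℝ → E} {γ' : E} {t : ℝ} (hγ : HasStrictDerivAt γ γ' t) (hγ' : γ' ≠ 0) {s : Set ℝ}
    (hs : s ∈ 𝓝 t) : ∃ (m : ℝ) (k : NNReal), (∀ x : unitInterval, t + m * x ∈ s) ∧
      AntilipschitzWith k fun x : unitInterval => γ (t + m * x) := by
  obtain ⟨k, -, hk⟩ := (HasDerivAtFilter.isTheta_sub hγ hγ').2.exists_nonneg
  rw [Asymptotics.IsBigOWith] at hk
  obtain ⟨ε, hε, hball⟩ := Metric.eventually_nhds_iff.1
    (hk.and (continuousAt_fst.eventually_mem hs))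
  have hdist : ∀ x : unitInterval, dist (t + ε / 2 * x) t < ε := fun x => by
    rw [Real.dist_eq, add_sub_cancel_left, abs_of_nonneg (mul_nonneg (half_pos hε).le x.2.1)]
    nlinarith [x.2.2]
  have hpair (x y : unitInterval) := hball (y := (t + ε / 2 * x, t + ε / 2 * y))
    (max_lt (hdist x) (hdist y))
  refine ⟨ε / 2, (2 / ε * k).toNNReal, fun x => (hpair x x).2,
    AntilipschitzWith.of_le_mul_dist fun x y => ?_⟩
  have hxy := (hpair x y).1
  rw [add_sub_add_left_eq_sub, ← mul_sub, norm_mul, Real.norm_of_nonneg (half_pos hε).le,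
    ← dist_eq_norm, ← dist_eq_norm] at hxy
  calc dist x y = 2 / ε * (ε / 2 * dist (x : ℝ) y) := by rw [Subtype.dist_eq]; field_simp
    _ ≤ 2 / ε * (k * dist (γ (t + ε / 2 * x)) (γ (t + ε / 2 * y))) := by gcongr
    _ ≤ _ := by
      rw [← mul_assoc]
      exact mul_le_mul_of_nonneg_right (Real.le_coe_toNNReal _) dist_nonneg

namespace IsArc

variable {A : Set ℂ}

lemma isCompact (hA : IsArc A) : IsCompact A := by
  obtain ⟨γ, hγ, -, rfl⟩ := hA
  exact isCompact_Icc.image_of_continuousOn hγ.continuousOn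

lemma hasPositiveCapacity (hA : IsArc A) : HasPositiveCapacity A := by
  obtain ⟨γ, hγ, hinj, rfl⟩ := hA
  have hsmooth : ∀ t ∈ Ioo (0 : ℝ) 1, ContDiffAt ℝ ∞ γ t := fun t ht =>
    hγ.contDiffAt (Icc_mem_nhds ht.1 ht.2)
  obtain ⟨t₀, ht₀, hne⟩ := exists_deriv_ne_zero_of_injOn zero_lt_one
    (fun t ht => ((hsmooth t ht).differentiableAt (by simp)).differentiableWithinAt)
    (hinj.mono Ioo_subset_Icc_self)
  obtain ⟨m, k, hmem, hanti⟩ := exists_antilipschitzWith_comp_affine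
    ((hsmooth t₀ ht₀).hasStrictDerivAt (by simp)) hne (Icc_mem_nhds ht₀.1 ht₀.2)
  exact hasPositiveCapacity_of_antilipschitz
    (hγ.continuousOn.comp_continuous (by fun_prop) hmem) hanti fun x => mem_image_of_mem γ (hmem x)

end IsArc

end Arc

section Superlevel

/-- The superlevel set `{U ≥ ε}` of a function on `ℂ × 𝔻̄`, in the coordinates `(v, τ)` with
`w = τ v`: boundary data on the twisted sets `τ K` become constraints on `K × ∂𝔻`. -/
def untwistedSuperlevel (U : ℂ × ℂ → EReal) (ε : ℝ) : Set (ℂ × ℂ) :=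
  {q | ‖q.2‖ ≤ 1 ∧ ε ≤ U (q.2 * q.1, q.2)}

variable {U : ℂ × ℂ → EReal} {K : Set ℂ} {ε : ℝ} {q : ℂ × ℂ}

lemma isClosed_untwistedSuperlevel (husc : UpperSemicontinuousOn U (univ ×ˢ closedBall 0 1)) :
    IsClosed (untwistedSuperlevel U ε) := by
  have hcomp : UpperSemicontinuousOn (fun q : ℂ × ℂ => U (q.2 * q.1, q.2))
      (univ ×ˢ closedBall 0 1) :=
    husc.comp (g := fun q : ℂ × ℂ => (q.2 * q.1, q.2)) (by fun_prop) fun _ hq => hq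
  obtain ⟨C, hC, hinter⟩ := upperSemicontinuousOn_iff_preimage_Ici.1 hcomp ε
  have heq : untwistedSuperlevel U ε = univ ×ˢ closedBall 0 1 ∩ C := by
    rw [← hinter]
    ext q
    simp [untwistedSuperlevel]
  exact heq ▸ (isClosed_univ.prod isClosed_closedBall).inter hC

lemma nonpos_of_mem (husc : UpperSemicontinuousOn U (univ ×ˢ closedBall 0 1))
    (hpsh : PlurisubharmonicOn U (univ ×ˢ ball 0 1))
    (hbd : ∀ a ∈ K, ∀ τ : ℂ, ‖τ‖ = 1 → U (τ * a, τ) ≤ 0) {a τ : ℂ} (ha : a ∈ K) (hτ : ‖τ‖ ≤ 1) :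
    U (τ * a, τ) ≤ 0 :=
  hpsh.le_on_disc_of_boundary (isOpen_univ.prod isOpen_ball) husc (f := fun ζ => (ζ * a, ζ))
    (c := 0) (r := 1) (M := 0) (by fun_prop) (fun ζ _ => by fun_prop) (fun ζ hζ => ⟨mem_univ _, hζ⟩)
    (fun ζ hζ => ⟨mem_univ _, hζ⟩) (fun ζ hζ => hbd a ha ζ (mem_sphere_zero_iff_norm.1 hζ)) τ
    (mem_closedBall_zero_iff.2 hτ)

lemma notMem_of_mem_untwistedSuperlevel
    (hnonpos : ∀ a ∈ K, ∀ τ : ℂ, ‖τ‖ ≤ 1 → U (τ * a, τ) ≤ 0) (hε : 0 < ε)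
    (hq : q ∈ untwistedSuperlevel U ε) : q.1 ∉ K := fun hqK =>
  (EReal.coe_pos.2 hε).not_ge (hq.2.trans (hnonpos _ hqK _ hq.1))

lemma exists_le_norm_snd_mul (husc : UpperSemicontinuousOn U (univ ×ˢ closedBall 0 1))
    (hU₀ : U 0 < ε) : ∃ ρ > 0, ∀ q ∈ untwistedSuperlevel U ε, ρ ≤ ‖q.2‖ * max 1 ‖q.1‖ := by
  have hmem : (0 : ℂ × ℂ) ∈ (univ ×ˢ closedBall 0 1 : Set (ℂ × ℂ)) := by simp
  obtain ⟨ρ, hρ, hball⟩ := Metric.eventually_nhds_iff.1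
    (eventually_nhdsWithin_iff.1 (husc 0 hmem ε hU₀))
  refine ⟨ρ, hρ, fun q hq => ?_⟩
  by_contra! hlt
  refine (hball (y := (q.2 * q.1, q.2)) ?_ ⟨mem_univ _, mem_closedBall_zero_iff.2 hq.1⟩).not_ge hq.2
  rw [dist_zero_right, Prod.norm_mk, norm_mul]
  refine max_lt (lt_of_le_of_lt ?_ hlt) (lt_of_le_of_lt ?_ hlt)
  · gcongr
    exact le_max_right _ _
  · exact le_mul_of_one_le_right (norm_nonneg _) (le_max_left _ _)

lemma snd_ne_zero_of_mem_untwistedSuperlevel (hU₀ : U 0 < ε)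
    (hq : q ∈ untwistedSuperlevel U ε) : q.2 ≠ 0 := fun h0 => by
  have hle := hq.2
  rw [h0, zero_mul] at hle
  exact hU₀.not_ge hle

lemma exists_neg_log_norm_le_of_le_norm
    (husc : UpperSemicontinuousOn U (univ ×ˢ closedBall 0 1)) (hU₀ : U 0 < ε) {h : ℂ → ℝ}
    (hgrowth : Tendsto (fun v => h v - Real.log ‖v‖) (Bornology.cobounded ℂ) atTop) :
    ∃ R, ∀ q ∈ untwistedSuperlevel U ε, R ≤ ‖q.1‖ → -Real.log ‖q.2‖ ≤ h q.1 := by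
  obtain ⟨ρ, hρ, hbound⟩ := exists_le_norm_snd_mul husc hU₀
  obtain ⟨R, -, hR⟩ := (hasBasis_cobounded_norm.eventually_iff).1
    (hgrowth.eventually_ge_atTop (-Real.log ρ))
  refine ⟨max 1 R, fun q hq hqR => ?_⟩
  have hq₁ : 1 ≤ ‖q.1‖ := (le_max_left _ _).trans hqR
  have hq₂ := snd_ne_zero_of_mem_untwistedSuperlevel hU₀ hq
  have hlog := Real.log_le_log hρ (hbound q hq)
  rw [max_eq_right hq₁, Real.log_mul (norm_ne_zero_iff.2 hq₂) (by positivity)] at hlog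
  linarith [hR ((le_max_right _ _).trans hqR)]

lemma exists_analyticAt_log_norm_eq {h : ℂ → ℝ} {v₀ τ₀ : ℂ}
    (hh : InnerProductSpace.HarmonicAt h v₀) (hτ₀ : τ₀ ≠ 0) :
    ∃ T : ℂ → ℂ, AnalyticAt ℂ T v₀ ∧ T v₀ = τ₀ ∧
      ∀ᶠ v in 𝓝 v₀, Real.log ‖T v‖ = Real.log ‖τ₀‖ + (h v - h v₀) := by
  obtain ⟨r, hr, hball⟩ := Metric.eventually_nhds_iff_ball.1 hh.eventually
  obtain ⟨F, hF, hFh⟩ := InnerProductSpace.HarmonicOnNhd.exists_analyticOnNhd_ball_re_eq hball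
  have hv₀ := mem_ball_self (x := v₀) hr
  have hF₀ := hF v₀ hv₀
  refine ⟨fun v => τ₀ * Complex.exp (F v - F v₀), by fun_prop, by simp, ?_⟩
  filter_upwards [ball_mem_nhds v₀ hr] with v hv
  rw [norm_mul, Real.log_mul (norm_ne_zero_iff.2 hτ₀) (norm_ne_zero_iff.2 (Complex.exp_ne_zero _)),
    Complex.norm_exp, Real.log_exp, Complex.sub_re]
  exact congrArg₂ _ rfl (congrArg₂ _ (hFh hv) (hFh hv₀))

lemma harmonicAt_sq_norm_sub_sq_norm_sub (v₀ v : ℂ) :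
    InnerProductSpace.HarmonicAt (fun v => ‖v‖ ^ 2 - ‖v - v₀‖ ^ 2) v := by
  have hre : (fun v : ℂ => ‖v‖ ^ 2 - ‖v - v₀‖ ^ 2) =
      fun v => ((starRingEnd ℂ) v₀ * (2 * v - v₀)).re := by
    ext v
    simp only [Complex.sq_norm, Complex.normSq_apply, Complex.mul_re, Complex.sub_re,
      Complex.sub_im, Complex.conj_re, Complex.conj_im, Complex.mul_im, Complex.re_ofNat,
      Complex.im_ofNat]
    ring
  rw [hre]
  exact (by fun_prop : AnalyticAt ℂ (fun v => (starRingEnd ℂ) v₀ * (2 * v - v₀)) v).harmonicAt_re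

/-- At a local maximum `(v₀, τ₀)`, the graph of a holomorphic function `T` with
`-log |T v| = h v - η ‖v‖² + η ‖v - v₀‖² + const` and `T v₀ = τ₀` would leave the superlevel set
at once, so that `U` would violate the maximum principle on the twisted graph. -/
lemma not_isLocalMaxOn_untwistedSuperlevel (hpsh : PlurisubharmonicOn U (univ ×ˢ ball 0 1))
    {h : ℂ → ℝ} (hh : InnerProductSpace.HarmonicAt h q.1) {η : ℝ} (hη : 0 < η)
    (hq : q ∈ untwistedSuperlevel U ε) (hq₀ : q.2 ≠ 0) (hq₁ : ‖q.2‖ < 1) :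
    ¬ IsLocalMaxOn (fun q : ℂ × ℂ => -Real.log ‖q.2‖ - h q.1 + η * ‖q.1‖ ^ 2)
      (untwistedSuperlevel U ε) q := by
  intro hmax
  obtain ⟨v₀, τ₀⟩ := q
  have hharm : InnerProductSpace.HarmonicAt
      (η • (fun v => ‖v‖ ^ 2 - ‖v - v₀‖ ^ 2) - h : ℂ → ℝ) v₀ :=
    (harmonicAt_sq_norm_sub_sq_norm_sub v₀ v₀).const_smul.sub hh
  obtain ⟨T, hT, hTv₀, hlog⟩ := exists_analyticAt_log_norm_eq (τ₀ := τ₀) hharm hq₀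
  have hgraph : Tendsto (fun v => (v, T v)) (𝓝 v₀) (𝓝 (v₀, τ₀)) :=
    hTv₀ ▸ (continuousAt_id.prodMk hT.continuousAt : ContinuousAt (fun v => (v, T v)) v₀)
  have hT₁ : ∀ᶠ v in 𝓝 v₀, ‖T v‖ < 1 :=
    hT.continuousAt.norm.eventually_lt_const (by simpa only [hTv₀] using hq₁)
  obtain ⟨s, hs, hball⟩ := Metric.nhds_basis_closedBall.eventually_iff.1
    (hT.eventually_analyticAt.and (hT₁.and (hlog.and
      (hgraph.eventually (eventually_nhdsWithin_iff.1 hmax)))))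
  have hlt := hpsh.lt_on_disc (isOpen_univ.prod isOpen_ball) hs.le
    (f := fun v => (T v * v, T v)) (c := v₀) (M := ε)
    (fun v hv => by have := (hball hv).1; fun_prop)
    (fun v hv => ⟨mem_univ _, mem_ball_zero_iff.2 (hball hv).2.1⟩) (fun v hv => ?_) v₀
    (mem_closedBall_self hs.le)
  · rw [hTv₀] at hlt
    exact hlt.not_ge hq.2
  · obtain ⟨-, hv₁, hvlog, hvmax⟩ := hball (sphere_subset_closedBall hv)
    by_contra! hle
    have hQ := hvmax ⟨hv₁.le, hle⟩
    simp only [hvlog, Pi.sub_apply, Pi.smul_apply, smul_eq_mul, mem_sphere_iff_norm.1 hv, sub_self,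
      norm_zero] at hQ
    nlinarith [mul_pos hη (pow_pos hs 2)]

lemma neg_log_norm_le_of_mem_untwistedSuperlevel
    (husc : UpperSemicontinuousOn U (univ ×ˢ closedBall 0 1))
    (hpsh : PlurisubharmonicOn U (univ ×ˢ ball 0 1)) (hU₀ : U 0 < ε)
    (havoid : ∀ q ∈ untwistedSuperlevel U ε, q.1 ∉ K) {h : ℂ → ℝ}
    (hh : ∀ v ∉ K, InnerProductSpace.HarmonicAt h v) (hh₀ : ∀ v ∉ K, 0 ≤ h v)
    (hgrowth : Tendsto (fun v => h v - Real.log ‖v‖) (Bornology.cobounded ℂ) atTop)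
    (hq : q ∈ untwistedSuperlevel U ε) : -Real.log ‖q.2‖ ≤ h q.1 := by
  by_contra! hlt
  obtain ⟨R, hfar⟩ := exists_neg_log_norm_le_of_le_norm husc hU₀ hgrowth
  obtain ⟨η, hη, hηR⟩ := exists_pos_mul_lt (sub_pos.2 hlt) (R ^ 2)
  set Q : ℂ × ℂ → ℝ := fun q => -Real.log ‖q.2‖ - h q.1 + η * ‖q.1‖ ^ 2
  have hQ : ContinuousOn Q (untwistedSuperlevel U ε) := fun q hq => by
    have hcont : ContinuousAt (fun q : ℂ × ℂ => h q.1) q :=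
      (hh q.1 (havoid q hq)).1.continuousAt.comp continuousAt_fst
    have hlog : ContinuousAt (fun q : ℂ × ℂ => Real.log ‖q.2‖) q :=
      continuousAt_snd.norm.log (norm_ne_zero_iff.2 (snd_ne_zero_of_mem_untwistedSuperlevel hU₀ hq))
    exact ((hlog.neg.sub hcont).add (by fun_prop)).continuousWithinAt
  have hqR : q ∈ closedBall (0 : ℂ) R ×ˢ closedBall (0 : ℂ) 1 :=
    ⟨mem_closedBall_zero_iff.2 (le_of_not_ge fun hge => (hfar q hq hge).not_gt hlt),
      mem_closedBall_zero_iff.2 hq.1⟩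
  obtain ⟨p, ⟨hp, hpR⟩, hmax⟩ := ((isCompact_closedBall (0 : ℂ) R).prod
    (isCompact_closedBall (0 : ℂ) 1) |>.inter_left
      (isClosed_untwistedSuperlevel husc)).exists_isMaxOn ⟨q, hq, hqR⟩ (hQ.mono inter_subset_left)
  have hpos : h p.1 < -Real.log ‖p.2‖ := by
    have hqp : Q q ≤ Q p := hmax ⟨hq, hqR⟩
    have hηp : ‖p.1‖ ^ 2 * η ≤ R ^ 2 * η := by
      gcongr
      exact mem_closedBall_zero_iff.1 hpR.1
    have := mul_nonneg hη.le (sq_nonneg ‖q.1‖)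
    simp only [Q] at hqp
    linarith
  have hp₁ : ‖p.1‖ < R := lt_of_not_ge fun hge => (hfar p hp hge).not_gt hpos
  have hp₂ : ‖p.2‖ < 1 := lt_of_not_ge fun hge => by
    linarith [Real.log_nonneg hge, hh₀ p.1 (havoid p hp)]
  refine not_isLocalMaxOn_untwistedSuperlevel hpsh (hh _ (havoid p hp)) hη hp
    (snd_ne_zero_of_mem_untwistedSuperlevel hU₀ hp) hp₂ ?_
  have hnhds : closedBall (0 : ℂ) R ×ˢ closedBall (0 : ℂ) 1 ∈ 𝓝 p :=
    prod_mem_nhds (closedBall_mem_nhds_of_mem (mem_ball_zero_iff.2 hp₁))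
      (closedBall_mem_nhds_of_mem (mem_ball_zero_iff.2 hp₂))
  filter_upwards [self_mem_nhdsWithin, nhdsWithin_le_nhds hnhds] with x hx hxR
  exact hmax ⟨hx, hxR⟩

lemma tendsto_smul_logPotential_sub_log_norm {μ : Measure ℂ} [IsProbabilityMeasure μ]
    (hK : IsCompact K) (hμ : ∀ᵐ x ∂μ, x ∈ K) (m : ℝ) {δ : ℝ} (hδ : 0 < δ) :
    Tendsto (fun v => (1 + δ) * (logPotential μ v - m) - Real.log ‖v‖) (Bornology.cobounded ℂ)
      atTop := by
  obtain ⟨R, hR, hKR⟩ := hK.isBounded.exists_pos_norm_le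
  have hlog : Tendsto (fun v : ℂ => δ * Real.log ‖v‖ - (1 + δ) * (Real.log 2 + m))
      (Bornology.cobounded ℂ) atTop :=
    tendsto_atTop_add_const_right _ _
      ((Real.tendsto_log_atTop.comp tendsto_norm_cobounded_atTop).const_mul_atTop hδ)
  refine tendsto_atTop_mono' _ ?_ hlog
  filter_upwards [tendsto_norm_cobounded_atTop.eventually_ge_atTop (2 * R)] with v hv
  have hpot : Real.log ‖v‖ - Real.log 2 ≤ logPotential μ v := by
    rw [← Real.log_div (by linarith) two_ne_zero]
    exact (Real.log_le_log (by linarith) (by linarith)).trans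
      (le_logPotential hK hμ hKR (by linarith))
  nlinarith

lemma neg_log_norm_le_logPotential_sub {μ : Measure ℂ} [IsProbabilityMeasure μ]
    (husc : UpperSemicontinuousOn U (univ ×ˢ closedBall 0 1))
    (hpsh : PlurisubharmonicOn U (univ ×ˢ ball 0 1)) (hK : IsCompact K) (hμ : ∀ᵐ x ∂μ, x ∈ K)
    {m : ℝ} (hm : ∀ v ∉ K, m ≤ logPotential μ v)
    (hnonpos : ∀ a ∈ K, ∀ τ : ℂ, ‖τ‖ ≤ 1 → U (τ * a, τ) ≤ 0) (hε : 0 < ε)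
    (hq : q ∈ untwistedSuperlevel U ε) : -Real.log ‖q.2‖ ≤ logPotential μ q.1 - m := by
  obtain ⟨a, ha⟩ := hμ.exists
  have hU₀ : U 0 < ε := by
    have h0 := hnonpos a ha 0 (by simp)
    rw [zero_mul] at h0
    exact h0.trans_lt (EReal.coe_pos.2 hε)
  have hδ : ∀ δ > 0, -Real.log ‖q.2‖ ≤ (1 + δ) * (logPotential μ q.1 - m) := fun δ hδ =>
    neg_log_norm_le_of_mem_untwistedSuperlevel husc hpsh hU₀
      (fun _ => notMem_of_mem_untwistedSuperlevel hnonpos hε)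
      (h := fun v => (1 + δ) * (logPotential μ v - m))
      (fun v hv => ((harmonicAt_logPotential hK hμ hv).sub
        (InnerProductSpace.harmonicAt_const m)).const_smul (c := 1 + δ))
      (fun v hv => mul_nonneg (by positivity) (sub_nonneg.2 (hm v hv)))
      (tendsto_smul_logPotential_sub_log_norm hK hμ m hδ) hq
  have hlim : Tendsto (fun δ => (1 + δ) * (logPotential μ q.1 - m)) (𝓝[>] 0)
      (𝓝 (logPotential μ q.1 - m)) :=
    tendsto_nhdsWithin_of_tendsto_nhds (Continuous.tendsto' (by fun_prop) _ _ (by ring))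
  exact ge_of_tendsto hlim (eventually_nhdsWithin_of_forall hδ)

lemma nonpos_of_norm_add_mul_norm_lt {μ : Measure ℂ} [IsProbabilityMeasure μ]
    (husc : UpperSemicontinuousOn U (univ ×ˢ closedBall 0 1))
    (hpsh : PlurisubharmonicOn U (univ ×ˢ ball 0 1)) (hK : IsCompact K) (hμ : ∀ᵐ x ∂μ, x ∈ K)
    {m : ℝ} (hm : ∀ v ∉ K, m ≤ logPotential μ v) {R : ℝ} (hR₀ : 0 < R)
    (hR : ∀ x ∈ K, ‖x‖ ≤ R) (hnonpos : ∀ a ∈ K, ∀ τ : ℂ, ‖τ‖ ≤ 1 → U (τ * a, τ) ≤ 0)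
    {w τ : ℂ} (hτ₀ : τ ≠ 0)
    (hτ : ‖τ‖ ≤ 1) (hw : ‖w‖ + R * ‖τ‖ < Real.exp m) : U (w, τ) ≤ 0 := by
  have hwτ : τ * (w / τ) = w := mul_div_cancel₀ w hτ₀
  by_cases hv : w / τ ∈ K
  · exact hwτ ▸ hnonpos _ hv τ hτ
  refine EReal.le_of_forall_lt_iff_le.1 fun ε hε => ?_
  by_contra! hlt
  have hle : -Real.log ‖τ‖ ≤ logPotential μ (w / τ) - m :=
    neg_log_norm_le_logPotential_sub husc hpsh hK hμ hm hnonpos (EReal.coe_pos.1 hε)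
      (q := (w / τ, τ)) ⟨hτ, by simpa only [hwτ] using hlt.le⟩
  have hτpos := norm_pos_iff.2 hτ₀
  have hpot : logPotential μ (w / τ) + Real.log ‖τ‖ ≤ Real.log (‖w‖ + R * ‖τ‖) := by
    have hsum : ‖w‖ + R * ‖τ‖ = (‖w / τ‖ + R) * ‖τ‖ := by
      rw [norm_div]
      field_simp
    rw [hsum, Real.log_mul (by positivity) hτpos.ne']
    linarith [logPotential_le hK hμ hR hv]
  have : Real.log (‖w‖ + R * ‖τ‖) < m := (Real.log_lt_iff_lt_exp (by positivity)).2 hw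
  linarith

/-- The region where the bound holds depends on `K` only, not on `U`. -/
lemma HasPositiveCapacity.exists_forall_nonpos (hcap : HasPositiveCapacity K) (hK : IsCompact K) :
    ∃ r > 0, r ≤ 1 ∧ ∀ U : ℂ × ℂ → EReal,
      UpperSemicontinuousOn U (univ ×ˢ closedBall 0 1) →
      PlurisubharmonicOn U (univ ×ˢ ball 0 1) →
      (∀ a ∈ K, ∀ τ : ℂ, ‖τ‖ = 1 → U (τ * a, τ) ≤ 0) →
      ∀ w τ : ℂ, ‖w‖ < r → ‖τ‖ < r → U (w, τ) ≤ 0 := by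
  obtain ⟨μ, _, hμ, m, hm⟩ := hcap
  obtain ⟨R, hR, hKR⟩ := hK.isBounded.exists_pos_norm_le
  refine ⟨min 1 (Real.exp m / (1 + R)), by positivity, min_le_left _ _,
    fun U husc hpsh hbd w τ hw hτ => ?_⟩
  set r := min 1 (Real.exp m / (1 + R))
  have hoff : ∀ τ : ℂ, τ ≠ 0 → ‖τ‖ < r → U (w, τ) ≤ 0 := fun τ hτ₀ hτ => by
    refine nonpos_of_norm_add_mul_norm_lt husc hpsh hK hμ hm hR hKR
      (fun a ha τ hτ => nonpos_of_mem husc hpsh hbd ha hτ) hτ₀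
      (hτ.le.trans (min_le_left _ _)) ?_
    have hr : r * (1 + R) ≤ Real.exp m := (le_div_iff₀ (by positivity)).1 (min_le_right _ _)
    nlinarith
  rcases ne_or_eq τ 0 with hτ₀ | rfl
  · exact hoff τ hτ₀ hτ
  have hr : 0 < r := (norm_nonneg w).trans_lt hw
  have hnorm : ∀ ζ : ℂ, ‖ζ * ((r / 2 : ℝ) : ℂ)‖ = ‖ζ‖ * (r / 2) := fun ζ => by
    rw [norm_mul, Complex.norm_of_nonneg (half_pos hr).le]
  have hpt : ∀ ζ : ℂ, (w, (0 : ℂ)) + ζ • ((0 : ℂ), ((r / 2 : ℝ) : ℂ)) =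
      (w, ζ * ((r / 2 : ℝ) : ℂ)) := fun ζ => by
    simp only [Prod.smul_mk, smul_eq_mul, Prod.mk_add_mk, mul_zero, add_zero, zero_add]
  have hmean := hpsh.2.2 (w, 0) (0, ((r / 2 : ℝ) : ℂ)) (fun ζ hζ => ?_) (fun _ => 0)
    continuousOn_const fun ζ hζ => ?_
  · rwa [Real.circleAverage_const] at hmean
  · rw [hpt, mem_prod, mem_ball_zero_iff, hnorm]
    have : r ≤ 1 := min_le_left _ _
    exact ⟨mem_univ w, by nlinarith [mem_closedBall_zero_iff.1 hζ]⟩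
  · have hζr : ‖ζ * ((r / 2 : ℝ) : ℂ)‖ = r / 2 := by
      rw [hnorm, mem_sphere_zero_iff_norm.1 hζ, one_mul]
    rw [hpt]
    exact hoff _ (norm_pos_iff.1 (hζr.symm ▸ half_pos hr)) (hζr.trans_lt (half_lt_self hr))

end Superlevel

section LogNorm

lemma circleAverage_mono_of_ne {f g : ℂ → ℝ} {c x : ℂ} {R : ℝ} (hf : CircleIntegrable f c R)
    (hg : CircleIntegrable g c R) (hR : R ≠ 0)
    (hle : ∀ ζ ∈ sphere c |R|, ζ ≠ x → f ζ ≤ g ζ) :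
    Real.circleAverage f c R ≤ Real.circleAverage g c R := by
  have heq : f =ᶠ[codiscreteWithin (sphere c |R|)] Function.update f x (g x) := by
    filter_upwards [compl_singleton_mem_codiscreteWithin x] with ζ hζ
    exact (Function.update_of_ne hζ _ _).symm
  rw [Real.circleAverage_congr_codiscreteWithin heq hR]
  refine Real.circleAverage_mono (hf.congr_codiscreteWithin heq) hg fun ζ hζ => ?_
  rcases eq_or_ne ζ x with rfl | hne
  · rw [Function.update_self]
  · rw [Function.update_of_ne hne]
    exact hle ζ hζ hne

lemma log_norm_add_mul_eq {a b ζ : ℂ} (hb : b ≠ 0) (h : a + ζ * b ≠ 0) :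
    Real.log ‖a + ζ * b‖ = Real.log ‖b‖ + Real.log ‖ζ - -(a / b)‖ := by
  have hfac : a + ζ * b = b * (ζ - -(a / b)) := by
    field_simp
    ring
  rw [hfac] at h ⊢
  rw [norm_mul, Real.log_mul (norm_ne_zero_iff.2 hb) (norm_ne_zero_iff.2 (right_ne_zero_of_mul h))]

lemma log_norm_le_circleAverage {a b : ℂ} {g : ℂ → ℝ} (hg : CircleIntegrable g 0 1) (ha : a ≠ 0)
    (hle : ∀ ζ ∈ sphere (0 : ℂ) 1, a + ζ * b ≠ 0 → Real.log ‖a + ζ * b‖ ≤ g ζ) :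
    Real.log ‖a‖ ≤ Real.circleAverage g 0 1 := by
  rcases eq_or_ne b 0 with rfl | hb
  · rw [← Real.circleAverage_const (Real.log ‖a‖) 0 1]
    refine Real.circleAverage_mono (circleIntegrable_const _ 0 1) hg fun ζ hζ => ?_
    simpa only [mul_zero, add_zero] using
      hle ζ (by rwa [abs_one] at hζ) (by rwa [mul_zero, add_zero])
  have hint : CircleIntegrable (fun ζ : ℂ => Real.log ‖ζ - -(a / b)‖) 0 1 :=
    circleIntegrable_log_norm_sub_const 1
  have hconst := circleIntegrable_const (Real.log ‖b‖) 0 1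
  calc Real.log ‖a‖ = Real.log ‖b‖ + Real.log ‖a / b‖ := by
        rw [norm_div, Real.log_div (norm_ne_zero_iff.2 ha) (norm_ne_zero_iff.2 hb)]
        ring
    _ ≤ Real.log ‖b‖ + Real.posLog ‖a / b‖ := by gcongr; exact le_max_right _ _
    _ = Real.circleAverage
          ((fun _ => Real.log ‖b‖) + fun ζ : ℂ => Real.log ‖ζ - -(a / b)‖) 0 1 := by
        rw [Real.circleAverage_add hconst hint, Real.circleAverage_const,
          circleAverage_log_norm_sub_const_eq_posLog, norm_neg]
    _ ≤ Real.circleAverage g 0 1 := by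
        refine circleAverage_mono_of_ne (x := -(a / b)) (hconst.add hint) hg one_ne_zero
          fun ζ hζ hne => ?_
        have h : a + ζ * b ≠ 0 := fun h => hne <| by
          rw [← neg_div, eq_div_iff hb, eq_neg_iff_add_eq_zero, add_comm, h]
        rw [abs_one] at hζ
        exact (log_norm_add_mul_eq hb h).ge.trans (hle ζ hζ h)

lemma plurisubharmonicOn_log_sq_norm :
    PlurisubharmonicOn (fun z : ℂ => ENNReal.log (ENNReal.ofReal (‖z‖ ^ 2))) univ := by
  have hlog : ∀ z : ℂ, z ≠ 0 →
      ENNReal.log (ENNReal.ofReal (‖z‖ ^ 2)) = ((2 * Real.log ‖z‖ : ℝ) : EReal) := fun z hz => by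
    rw [ENNReal.log_ofReal_of_pos (by positivity), Real.log_pow, Nat.cast_two]
  have hcont : Continuous fun z : ℂ => ENNReal.log (ENNReal.ofReal (‖z‖ ^ 2)) :=
    ENNReal.continuous_log.comp (ENNReal.continuous_ofReal.comp (by fun_prop))
  refine ⟨hcont.upperSemicontinuous.upperSemicontinuousOn _,
    fun p _ => ENNReal.log_eq_top_iff.not.2 ENNReal.ofReal_ne_top, fun a b _ g hg hle => ?_⟩
  rcases eq_or_ne a 0 with rfl | ha
  · simp
  have hmean := log_norm_le_circleAverage (a := a) (b := b) (g := (2⁻¹ : ℝ) • g)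
    ((hg.circleIntegrable zero_le_one).const_smul (a := (2⁻¹ : ℝ))) ha fun ζ hζ hne => by
      have h := hle ζ hζ
      simp only [smul_eq_mul, hlog _ hne, EReal.coe_le_coe_iff] at h
      rw [Pi.smul_apply, smul_eq_mul]
      linarith
  rw [Real.circleAverage_smul, smul_eq_mul] at hmean
  simp only [hlog a ha, EReal.coe_le_coe_iff]
  linarith

end LogNorm

section

variable {E : Type*} [NormedAddCommGroup E] [NormedSpace ℂ E]

lemma PlurisubharmonicOn.mono {u : E → EReal} {Ω Ω' : Set E} (hu : PlurisubharmonicOn u Ω)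
    (h : Ω' ⊆ Ω) : PlurisubharmonicOn u Ω' :=
  ⟨hu.1.mono h, fun p hp => hu.2.1 p (h hp), fun a b hab => hu.2.2 a b fun ζ hζ => h (hab ζ hζ)⟩

lemma plurisubharmonicOn_zero (Ω : Set E) :
    PlurisubharmonicOn (fun _ : E => 0) Ω := by
  refine ⟨upperSemicontinuousOn_const, fun _ _ => EReal.zero_ne_top, fun a b _ g _ hle => ?_⟩
  exact EReal.coe_nonneg.2 (Real.circleAverage_nonneg_of_nonneg fun ζ hζ =>
    EReal.coe_nonneg.1 (hle ζ (by rwa [abs_one] at hζ)))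

end

namespace P1

lemma chartW_zero : chartW 0 = OnePoint.infty := if_pos rfl

lemma chartW_of_ne_zero {w : ℂ} (hw : w ≠ 0) : chartW w = chartZ w⁻¹ := if_neg hw

lemma eq_chartZ_zero_or_exists_eq_chartW (x : P1) : x = chartZ 0 ∨ ∃ w, x = chartW w := by
  induction x using OnePoint.rec with
  | infty => exact Or.inr ⟨0, chartW_zero.symm⟩
  | coe z =>
    rcases eq_or_ne z 0 with rfl | hz
    · exact Or.inl rfl
    · exact Or.inr ⟨z⁻¹, by rw [chartW_of_ne_zero (inv_ne_zero hz), inv_inv]; rfl⟩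

lemma rot_chartW {τ : ℂ} (hτ : τ ≠ 0) (w : ℂ) : rot τ (chartW (τ * w)) = chartW w := by
  rcases eq_or_ne w 0 with rfl | hw
  · rw [mul_zero, chartW_zero]
    rfl
  · rw [chartW_of_ne_zero hw, chartW_of_ne_zero (mul_ne_zero hτ hw), mul_inv]
    exact congrArg chartZ (mul_inv_cancel_left₀ hτ w⁻¹)

lemma continuous_chartZ : Continuous chartZ := OnePoint.continuous_coe

lemma continuous_chartW : Continuous chartW := by
  refine continuous_iff_continuousAt.2 fun w => ?_
  rcases eq_or_ne w 0 with rfl | hw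
  · rw [continuousAt_iff_punctured_nhds, chartW_zero]
    have hinv : Tendsto (fun w : ℂ => chartZ w⁻¹) (𝓝[≠] 0) (𝓝 OnePoint.infty) :=
      OnePoint.tendsto_coe_infty.comp <| by
        rw [coclosedCompact_eq_cocompact, ← Metric.cobounded_eq_cocompact]
        exact tendsto_inv₀_nhdsNE_zero
    exact hinv.congr' (eventually_nhdsWithin_of_forall fun x hx => (chartW_of_ne_zero hx).symm)
  · refine ((continuous_chartZ.continuousAt.comp (continuousAt_inv₀ hw))).congr ?_
    filter_upwards [isOpen_ne.mem_nhds hw] with x hx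
    exact (chartW_of_ne_zero hx).symm

lemma continuous_of_mem_charts {κ : ℂ → P1} (hκ : κ ∈ charts) : Continuous κ := by
  rcases hκ with rfl | rfl
  exacts [continuous_chartZ, continuous_chartW]

lemma continuous_fsPotential : Continuous fsPotential :=
  (by fun_prop : Continuous fun ζ : ℂ => 1 + ‖ζ‖ ^ 2).log fun ζ => by positivity

lemma fsPotential_eq_of_norm_eq {x y : ℂ} (h : ‖x‖ = ‖y‖) : fsPotential x = fsPotential y := by
  rw [fsPotential, fsPotential, h]

/-- The squared Fubini-Study norm `|z|² / (1 + |z|²)` of the section of `𝒪(1)` that vanishes at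
`z = 0`. -/
noncomputable def fsNormSq (x : P1) : ℝ := OnePoint.elim x 1 fun z => ‖z‖ ^ 2 / (1 + ‖z‖ ^ 2)

lemma fsNormSq_chartZ (z : ℂ) : fsNormSq (chartZ z) = ‖z‖ ^ 2 / (1 + ‖z‖ ^ 2) := rfl

lemma fsNormSq_chartW (w : ℂ) : fsNormSq (chartW w) = (1 + ‖w‖ ^ 2)⁻¹ := by
  rcases eq_or_ne w 0 with rfl | hw
  · rw [chartW_zero, norm_zero]
    norm_num [fsNormSq]
  · rw [chartW_of_ne_zero hw, fsNormSq_chartZ, norm_inv]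
    have := norm_pos_iff.2 hw
    field_simp
    ring

lemma chartW_ne_chartZ_zero (w : ℂ) : chartW w ≠ chartZ 0 := fun h => by
  have := congrArg fsNormSq h
  rw [fsNormSq_chartW, fsNormSq_chartZ, norm_zero, zero_pow two_ne_zero, zero_div] at this
  exact absurd this (by positivity)

lemma continuous_fsNormSq : Continuous fsNormSq := by
  refine OnePoint.continuous_iff _ |>.2 ⟨?_, ?_⟩
  · have hlim : Tendsto (fun z : ℂ => 1 - (1 + ‖z‖ ^ 2)⁻¹) (coclosedCompact ℂ) (𝓝 (1 - 0)) := by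
      refine tendsto_const_nhds.sub (tendsto_inv_atTop_zero.comp ?_)
      rw [coclosedCompact_eq_cocompact]
      exact tendsto_atTop_add_const_left _ _
        ((tendsto_pow_atTop two_ne_zero).comp tendsto_norm_cocompact_atTop)
    rw [sub_zero] at hlim
    refine hlim.congr fun z => ?_
    have hz : (1 : ℝ) + ‖z‖ ^ 2 ≠ 0 := by positivity
    rw [eq_comm, ← chartZ, fsNormSq_chartZ, div_eq_iff hz, sub_mul, inv_mul_cancel₀ hz]
    ring
  · exact (by fun_prop : Continuous fun z : ℂ => ‖z‖ ^ 2).div (by fun_prop) fun z => by positivity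

lemma image_chartW_ball {r : ℝ} (hr : 0 < r) :
    chartW '' ball 0 r = {x | (1 + r ^ 2)⁻¹ < fsNormSq x} := by
  ext x
  have hW : ∀ w : ℂ, (1 + r ^ 2)⁻¹ < fsNormSq (chartW w) ↔ ‖w‖ < r := fun w => by
    rw [fsNormSq_chartW, inv_lt_inv₀ (by positivity) (by positivity), add_lt_add_iff_left,
      sq_lt_sq₀ (norm_nonneg w) hr.le]
  refine ⟨fun ⟨w, hw, hx⟩ => hx ▸ (hW w).2 (mem_ball_zero_iff.1 hw), fun hx => ?_⟩
  rcases eq_chartZ_zero_or_exists_eq_chartW x with rfl | ⟨w, rfl⟩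
  · rw [mem_ofPred_eq, fsNormSq_chartZ, norm_zero, zero_pow two_ne_zero, zero_div] at hx
    exact absurd hx (by positivity : (0 : ℝ) < (1 + r ^ 2)⁻¹).not_gt
  · exact ⟨w, mem_ball_zero_iff.2 ((hW w).1 hx), rfl⟩

lemma isOpen_image_chartW_ball {r : ℝ} (hr : 0 < r) : IsOpen (chartW '' ball 0 r) := by
  rw [image_chartW_ball hr]
  exact isOpen_lt continuous_const continuous_fsNormSq

end P1

namespace HMAE

open P1

/-- The competitor `log (|z|² / (1 + |z|²)) = -log (1 + |w|²)`, whose current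
`ω_FS + dd^c poleCandidate` is the point mass at `z = 0` in every fibre. -/
noncomputable def poleCandidate (p : P1 × ℂ) : EReal :=
  ENNReal.log (ENNReal.ofReal (fsNormSq p.1))

lemma poleCandidate_chartW (w τ : ℂ) :
    poleCandidate (chartW w, τ) = ((-fsPotential w : ℝ) : EReal) := by
  rw [poleCandidate, fsNormSq_chartW, ENNReal.log_ofReal_of_pos (by positivity), Real.log_inv,
    fsPotential]

lemma poleCandidate_chartZ_zero (τ : ℂ) : poleCandidate (chartZ 0, τ) = ⊥ := by
  simp [poleCandidate, fsNormSq_chartZ]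

lemma fsPotential_add_poleCandidate_chartZ (z τ : ℂ) :
    (fsPotential z : EReal) + poleCandidate (chartZ z, τ) =
      ENNReal.log (ENNReal.ofReal (‖z‖ ^ 2)) := by
  have h : (0 : ℝ) < 1 + ‖z‖ ^ 2 := by positivity
  rw [poleCandidate, fsNormSq_chartZ, fsPotential, ← ENNReal.log_ofReal_of_pos h,
    ← ENNReal.log_mul_add, ← ENNReal.ofReal_mul h.le, mul_div_cancel₀ _ h.ne']

lemma fsPotential_add_poleCandidate_chartW (w τ : ℂ) :
    (fsPotential w : EReal) + poleCandidate (chartW w, τ) = 0 := by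
  rw [poleCandidate_chartW, ← EReal.coe_add, add_neg_cancel, EReal.coe_zero]

lemma continuous_poleCandidate : Continuous poleCandidate :=
  ENNReal.continuous_log.comp
    (ENNReal.continuous_ofReal.comp (continuous_fsNormSq.comp continuous_fst))

lemma isOmegaPsh_poleCandidate : IsOmegaPsh poleCandidate := by
  rintro κ (rfl | rfl)
  · simp only [fsPotential_add_poleCandidate_chartZ]
    exact PlurisubharmonicOn.mono (plurisubharmonicOn_log_sq_norm.comp_continuousLinearMap
      (ContinuousLinearMap.fst ℂ ℂ ℂ)) (subset_univ _)
  · simp only [fsPotential_add_poleCandidate_chartW]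
    exact plurisubharmonicOn_zero _

variable {φ : P1 → ℝ}

lemma isCandidate_poleCandidate (hge : ∀ w : ℂ, -Real.log (1 + ‖w‖ ^ 2) ≤ φ (chartW w)) :
    IsCandidate (fun p : P1 × ℂ => φ (rot p.2 p.1)) poleCandidate := by
  refine ⟨continuous_poleCandidate.upperSemicontinuous.upperSemicontinuousOn _,
    fun p _ => ENNReal.log_eq_top_iff.not.2 ENNReal.ofReal_ne_top,
    isOmegaPsh_poleCandidate, fun x τ hτ => ?_⟩
  rw [mem_sphere_zero_iff_norm] at hτ
  rcases eq_chartZ_zero_or_exists_eq_chartW x with rfl | ⟨w, rfl⟩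
  · exact poleCandidate_chartZ_zero τ ▸ bot_le
  have hτ₀ : τ ≠ 0 := norm_ne_zero_iff.1 (hτ ▸ one_ne_zero)
  have hrot : rot τ (chartW w) = chartW (τ⁻¹ * w) := by
    simpa only [mul_inv_cancel_left₀ hτ₀] using rot_chartW hτ₀ (τ⁻¹ * w)
  have hnorm : ‖w‖ = ‖τ⁻¹ * w‖ := by rw [norm_mul, norm_inv, hτ, inv_one, one_mul]
  simp only [poleCandidate_chartW, EReal.coe_le_coe_iff, hrot, fsPotential_eq_of_norm_eq hnorm]
  exact hge _

lemma IsCandidate.upperSemicontinuousOn_chartW {F : P1 × ℂ → ℝ} {ψ : P1 × ℂ → EReal}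
    (hψ : IsCandidate F ψ) :
    UpperSemicontinuousOn (fun q : ℂ × ℂ => (fsPotential q.1 : EReal) + ψ (chartW q.1, q.2))
      (univ ×ˢ closedBall 0 1) := by
  refine UpperSemicontinuousOn.add' ?_ ?_ fun q _ =>
    EReal.continuousAt_add (Or.inl (EReal.coe_ne_top _)) (Or.inl (EReal.coe_ne_bot _))
  · exact (continuous_coe_real_ereal.comp
      (continuous_fsPotential.comp continuous_fst)).upperSemicontinuous.upperSemicontinuousOn _
  · exact hψ.1.comp (g := fun q : ℂ × ℂ => (chartW q.1, q.2))
      ((continuous_chartW.comp continuous_fst).prodMk continuous_snd).continuousOn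
      fun q hq => ⟨mem_univ _, hq.2⟩

lemma IsCandidate.fsPotential_add_chartW_le_zero {ψ : P1 × ℂ → EReal}
    (hψ : IsCandidate (fun p : P1 × ℂ => φ (rot p.2 p.1)) ψ) {a τ : ℂ}
    (ha : φ (chartW a) = -Real.log (1 + ‖a‖ ^ 2)) (hτ : ‖τ‖ = 1) :
    (fsPotential (τ * a) : EReal) + ψ (chartW (τ * a), τ) ≤ 0 := by
  have hbd := hψ.2.2.2 (chartW (τ * a)) τ (mem_sphere_zero_iff_norm.2 hτ)
  simp only [rot_chartW (norm_ne_zero_iff.1 (hτ ▸ one_ne_zero)), ha] at hbd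
  have hnorm : ‖τ * a‖ = ‖a‖ := by rw [norm_mul, hτ, one_mul]
  calc (fsPotential (τ * a) : EReal) + ψ (chartW (τ * a), τ)
      ≤ fsPotential a + ((-fsPotential a : ℝ) : EReal) := by
        rw [fsPotential_eq_of_norm_eq hnorm]
        exact add_le_add_right hbd _
    _ = 0 := by rw [← EReal.coe_add, add_neg_cancel, EReal.coe_zero]

lemma exists_weakSolution_eq_poleCandidate
    (hge : ∀ w : ℂ, -Real.log (1 + ‖w‖ ^ 2) ≤ φ (chartW w)) {K : Set ℂ} (hK : IsCompact K)
    (hcap : HasPositiveCapacity K) (hKφ : ∀ w ∈ K, φ (chartW w) = -Real.log (1 + ‖w‖ ^ 2)) :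
    ∃ r > 0, r ≤ 1 ∧ EqOn (weakSolution fun p : P1 × ℂ => φ (rot p.2 p.1)) poleCandidate
      ((chartW '' ball 0 r) ×ˢ ball 0 r) := by
  obtain ⟨r, hr, hr₁, hle⟩ := hcap.exists_forall_nonpos hK
  refine ⟨r, hr, hr₁, ?_⟩
  rintro ⟨_, τ⟩ ⟨⟨w, hw, rfl⟩, hτ⟩
  refine le_antisymm (iSup₂_le fun ψ hψ => ?_)
    (le_iSup₂_of_le poleCandidate (isCandidate_poleCandidate hge) le_rfl)
  have hnonpos := hle _ hψ.upperSemicontinuousOn_chartW (hψ.2.2.1 chartW (Or.inr rfl))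
    (fun a ha τ hτ => hψ.fsPotential_add_chartW_le_zero (hKφ a ha) hτ) w τ
    (mem_ball_zero_iff.1 hw) (mem_ball_zero_iff.1 hτ)
  rwa [poleCandidate_chartW, EReal.coe_neg, ← zero_sub, EReal.le_sub_iff_add_le
    (Or.inl (EReal.coe_ne_bot _)) (Or.inl (EReal.coe_ne_top _)), add_comm]

end HMAE

section SecondDirDeriv

/-- The second derivative of `χ` at `p` in the direction `v`. -/
noncomputable def secondDirDeriv {E : Type*} [NormedAddCommGroup E] [NormedSpace ℝ E]
    (χ : E → ℝ) (p v : E) : ℝ :=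
  fderiv ℝ (fun q => fderiv ℝ χ q v) p v

variable {E F : Type*} [NormedAddCommGroup E] [NormedSpace ℝ E] [NormedAddCommGroup F]
  [NormedSpace ℝ F] {χ f : E → ℝ} {p : E}

lemma iteratedFDeriv_two_eq_secondDirDeriv (h : ContDiffAt ℝ 2 χ p) (v : E) :
    iteratedFDeriv ℝ 2 χ p ![v, v] = secondDirDeriv χ p v := by
  have hd : DifferentiableAt ℝ (fderiv ℝ χ) p :=
    (h.fderiv_right (m := 1) (by norm_num)).differentiableAt (by simp)
  rw [iteratedFDeriv_two_apply, secondDirDeriv, fderiv_clm_apply hd (differentiableAt_const v)]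
  simp

lemma secondDirDeriv_comp_add_clm (h : ContDiffAt ℝ 2 χ p) (L : F →L[ℝ] E) (v : F) :
    secondDirDeriv (fun x => χ (p + L x)) 0 v = secondDirDeriv χ p (L v) := by
  have hL : ∀ x, HasFDerivAt (fun x => p + L x) L x := fun x => L.hasFDerivAt.const_add p
  have hp : p = p + L 0 := by rw [map_zero, add_zero]
  have hd : DifferentiableAt ℝ (fun q => fderiv ℝ χ q (L v)) (p + L 0) := by
    rw [← hp]
    exact ((h.fderiv_right (m := 1) (by norm_num)).differentiableAt (by simp)).clm_apply
      (differentiableAt_const _)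
  have hev : ∀ᶠ q in 𝓝 (p + L 0), DifferentiableAt ℝ χ q := by
    rw [← hp]
    exact (h.eventually (by simp)).mono fun q hq => hq.differentiableAt (by simp)
  have hfirst : (fun x => fderiv ℝ (fun x => χ (p + L x)) x v) =ᶠ[𝓝 0]
      fun x => fderiv ℝ χ (p + L x) (L v) := by
    filter_upwards [(hL 0).continuousAt.eventually hev] with x hx
    exact congrArg (· v) (hx.hasFDerivAt.comp x (hL x)).fderiv
  rw [secondDirDeriv, hfirst.fderiv_eq]
  refine (congrArg (· v) (hd.hasFDerivAt.comp 0 (hL 0)).fderiv).trans ?_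
  rw [← hp]
  rfl

section IntegrationByParts

lemma integrable_mul_of_tsupport_subset {X : Type*} [TopologicalSpace X] [MeasurableSpace X]
    [OpensMeasurableSpace X] {μ : Measure X} [IsFiniteMeasureOnCompacts μ] {f g : X → ℝ}
    {O : Set X} (hO : IsOpen O) (hf : ContinuousOn f O) (hg : Continuous g)
    (hgc : HasCompactSupport g) (hgO : tsupport g ⊆ O) : Integrable (fun x => f x * g x) μ := by
  have hcont : Continuous fun x => f x * g x := continuous_of_tsupport fun _ hx =>
    (hf.continuousAt (hO.mem_nhds (hgO (tsupport_mul_subset_right hx)))).mul hg.continuousAt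
  exact hcont.integrable_of_hasCompactSupport hgc.mul_left

variable {O : Set E}

lemma contDiffOn_fderiv_apply (hO : IsOpen O) (hf : ContDiffOn ℝ 2 f O) (v : E) :
    ContDiffOn ℝ 1 (fun x => fderiv ℝ f x v) O :=
  (hf.fderiv_of_isOpen hO (m := 1) (by norm_num)).clm_apply contDiffOn_const

lemma continuousOn_fderiv_apply (hO : IsOpen O) (hf : ContDiffOn ℝ 1 f O) (v : E) :
    ContinuousOn (fun x => fderiv ℝ f x v) O :=
  (hf.continuousOn_fderiv_of_isOpen hO le_rfl).clm_apply continuousOn_const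

lemma continuousOn_secondDirDeriv (hO : IsOpen O) (hf : ContDiffOn ℝ 2 f O) (v : E) :
    ContinuousOn (fun x => secondDirDeriv f x v) O :=
  continuousOn_fderiv_apply hO (contDiffOn_fderiv_apply hO hf v) v

lemma tsupport_secondDirDeriv_subset (χ : E → ℝ) (v : E) :
    tsupport (fun x => secondDirDeriv χ x v) ⊆ tsupport χ :=
  (tsupport_fderiv_apply_subset ℝ v).trans (tsupport_fderiv_apply_subset ℝ v)

variable [MeasurableSpace E] [BorelSpace E] {μ : Measure E}

lemma integrable_mul_secondDirDeriv [IsFiniteMeasureOnCompacts μ] (hO : IsOpen O)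
    (hf : ContinuousOn f O) (hχ : ContDiff ℝ 2 χ) (hχc : HasCompactSupport χ)
    (hχO : tsupport χ ⊆ O) (v : E) : Integrable (fun x => f x * secondDirDeriv χ x v) μ :=
  integrable_mul_of_tsupport_subset hO hf
    (continuousOn_univ.1 (continuousOn_secondDirDeriv isOpen_univ hχ.contDiffOn v))
    ((hχc.fderiv_apply ℝ v).fderiv_apply ℝ v) ((tsupport_secondDirDeriv_subset χ v).trans hχO)

lemma integrable_secondDirDeriv_mul [IsFiniteMeasureOnCompacts μ] (hO : IsOpen O)
    (hf : ContDiffOn ℝ 2 f O) (hχ : Continuous χ) (hχc : HasCompactSupport χ)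
    (hχO : tsupport χ ⊆ O) (v : E) : Integrable (fun x => secondDirDeriv f x v * χ x) μ :=
  integrable_mul_of_tsupport_subset hO (continuousOn_secondDirDeriv hO hf v) hχ hχc hχO

variable [FiniteDimensional ℝ E] [μ.IsAddHaarMeasure]

lemma integral_mul_fderiv_of_tsupport_subset (hO : IsOpen O) (hf : ContDiffOn ℝ 1 f O)
    (hχ : ContDiff ℝ 1 χ) (hχc : HasCompactSupport χ) (hχO : tsupport χ ⊆ O) (v : E) :
    ∫ x, f x * fderiv ℝ χ x v ∂μ = -∫ x, fderiv ℝ f x v * χ x ∂μ :=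
  integral_mul_fderiv_eq_neg_fderiv_mul_of_integrable
    (integrable_mul_of_tsupport_subset hO (continuousOn_fderiv_apply hO hf v) hχ.continuous
      hχc hχO)
    (integrable_mul_of_tsupport_subset hO hf.continuousOn
      ((hχ.continuous_fderiv (by simp)).clm_apply continuous_const) (hχc.fderiv_apply ℝ v)
      ((tsupport_fderiv_apply_subset ℝ v).trans hχO))
    (integrable_mul_of_tsupport_subset hO hf.continuousOn hχ.continuous hχc hχO)
    (fun _ hx => (hf.contDiffAt (hO.mem_nhds (hχO hx))).differentiableAt (by simp))
    (fun _ _ => hχ.contDiffAt.differentiableAt (by simp))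

lemma integral_mul_secondDirDeriv (hO : IsOpen O) (hf : ContDiffOn ℝ 2 f O)
    (hχ : ContDiff ℝ 2 χ) (hχc : HasCompactSupport χ) (hχO : tsupport χ ⊆ O) (v : E) :
    ∫ x, f x * secondDirDeriv χ x v ∂μ = ∫ x, secondDirDeriv f x v * χ x ∂μ := by
  have hχ' : ContDiff ℝ 1 fun x => fderiv ℝ χ x v :=
    contDiffOn_univ.1 (contDiffOn_fderiv_apply isOpen_univ hχ.contDiffOn v)
  calc ∫ x, f x * secondDirDeriv χ x v ∂μ = -∫ x, fderiv ℝ f x v * fderiv ℝ χ x v ∂μ :=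
        integral_mul_fderiv_of_tsupport_subset hO (hf.of_le (by norm_num)) hχ'
          (hχc.fderiv_apply ℝ v) ((tsupport_fderiv_apply_subset ℝ v).trans hχO) v
    _ = ∫ x, secondDirDeriv f x v * χ x ∂μ := by
        rw [integral_mul_fderiv_of_tsupport_subset hO (contDiffOn_fderiv_apply hO hf v)
          (hχ.of_le (by norm_num)) hχc hχO v, neg_neg]
        rfl

end IntegrationByParts

end SecondDirDeriv

section Ddc

variable {E : Type*} [NormedAddCommGroup E] [NormedSpace ℂ E] {χ f : E → ℝ} {p : E}

lemma ddc_eq_secondDirDeriv (h : ContDiffAt ℝ 2 χ p) (b : E) :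
    ddc χ p b = (1 / (4 * Real.pi)) *
      (secondDirDeriv χ p b + secondDirDeriv χ p (Complex.I • b)) := by
  set L : ℂ →L[ℝ] E := (ContinuousLinearMap.toSpanSingleton ℂ b).restrictScalars ℝ
  have hχL : ContDiffAt ℝ 2 (fun ζ : ℂ => χ (p + L ζ)) 0 := by
    refine ContDiffAt.comp (g := χ) (f := fun ζ : ℂ => p + L ζ) 0 ?_ (by fun_prop)
    rwa [map_zero, add_zero]
  have hdir : ∀ m : ℂ, iteratedFDeriv ℝ 2 (fun ζ : ℂ => χ (p + ζ • b)) 0 ![m, m] =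
      secondDirDeriv χ p (m • b) := fun m =>
    (iteratedFDeriv_two_eq_secondDirDeriv hχL m).trans (secondDirDeriv_comp_add_clm h L m)
  rw [ddc, InnerProductSpace.laplacian_eq_iteratedFDeriv_complexPlane]
  simp only [hdir, one_smul]

lemma ddc_congr_nhds {χ' : E → ℝ} (h : χ =ᶠ[𝓝 p] χ') (b : E) : ddc χ p b = ddc χ' p b := by
  have htend : Tendsto (fun ζ : ℂ => p + ζ • b) (𝓝 0) (𝓝 p) :=
    Continuous.tendsto' (by fun_prop) _ _ (by rw [zero_smul, add_zero])
  exact congrArg (1 / (4 * Real.pi) * ·)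
    (InnerProductSpace.laplacian_congr_nhds (h.comp_tendsto htend)).eq_of_nhds

lemma ddc_const (c : ℝ) (p b : E) : ddc (fun _ => c) p b = 0 := by
  simp [ddc]

lemma ddc_eq_zero_of_notMem_tsupport (h : p ∉ tsupport χ) (b : E) : ddc χ p b = 0 :=
  (ddc_congr_nhds (notMem_tsupport_iff_eventuallyEq.1 h) b).trans (ddc_const 0 p b)

variable [MeasurableSpace E] {μ : Measure E}

lemma integral_mul_ddc_congr {g : E → ℝ} (h : EqOn f g (tsupport χ)) (b : E) :
    ∫ x, f x * ddc χ x b ∂μ = ∫ x, g x * ddc χ x b ∂μ := by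
  congr 1 with x
  by_cases hx : x ∈ tsupport χ
  · rw [h hx]
  · rw [ddc_eq_zero_of_notMem_tsupport hx, mul_zero, mul_zero]

lemma integral_mul_ddc [BorelSpace E] [FiniteDimensional ℝ E] [μ.IsAddHaarMeasure] {O : Set E}
    (hO : IsOpen O) (hf : ContDiffOn ℝ 2 f O) (hχ : ContDiff ℝ 2 χ) (hχc : HasCompactSupport χ)
    (hχO : tsupport χ ⊆ O) (b : E) :
    ∫ x, f x * ddc χ x b ∂μ = ∫ x, ddc f x b * χ x ∂μ := by
  have hleft : ∀ x, f x * ddc χ x b = (1 / (4 * Real.pi)) *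
      (f x * secondDirDeriv χ x b + f x * secondDirDeriv χ x (Complex.I • b)) := fun x => by
    rw [ddc_eq_secondDirDeriv hχ.contDiffAt]
    ring
  have hright : ∀ x, ddc f x b * χ x = (1 / (4 * Real.pi)) *
      (secondDirDeriv f x b * χ x + secondDirDeriv f x (Complex.I • b) * χ x) := fun x => by
    by_cases hx : x ∈ tsupport χ
    · rw [ddc_eq_secondDirDeriv (hf.contDiffAt (hO.mem_nhds (hχO hx)))]
      ring
    · simp only [image_eq_zero_of_notMem_tsupport hx, mul_zero, add_zero]
  simp only [hleft, hright]
  rw [integral_const_mul, integral_const_mul,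
    integral_add (integrable_mul_secondDirDeriv hO hf.continuousOn hχ hχc hχO _)
      (integrable_mul_secondDirDeriv hO hf.continuousOn hχ hχc hχO _),
    integral_add (integrable_secondDirDeriv_mul hO hf hχ.continuous hχc hχO _)
      (integrable_secondDirDeriv_mul hO hf hχ.continuous hχc hχO _),
    integral_mul_secondDirDeriv hO hf hχ hχc hχO, integral_mul_secondDirDeriv hO hf hχ hχc hχO]

lemma ddc_log_norm_fst {q : ℂ × ℂ} (hq : q.1 ≠ 0) (b : ℂ × ℂ) :
    ddc (fun q : ℂ × ℂ => 2 * Real.log ‖q.1‖) q b = 0 := by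
  have hline : AnalyticAt ℂ (fun ζ : ℂ => q.1 + ζ * b.1) 0 := by fun_prop
  have hharm := (hline.harmonicAt_log_norm (by simpa using hq)).const_smul (c := (2 : ℝ))
  rw [ddc]
  exact mul_eq_zero_of_right _ hharm.2.eq_of_nhds

lemma contDiffOn_log_norm_fst :
    ContDiffOn ℝ 2 (fun q : ℂ × ℂ => 2 * Real.log ‖q.1‖) {q | q.1 ≠ 0} := fun _ hq =>
  (contDiffAt_const.mul
    ((contDiffAt_fst.norm ℝ hq).log (norm_ne_zero_iff.2 hq))).contDiffWithinAt

end Ddc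

namespace P1

open scoped RealInnerProductSpace

lemma contDiff_fsPotential : ContDiff ℝ 2 fsPotential :=
  (contDiff_const.add (contDiff_norm_sq ℝ)).log fun ζ => by positivity

lemma fderiv_fsPotential_apply (ζ v : ℂ) :
    fderiv ℝ fsPotential ζ v = 2 * ⟪ζ, v⟫ * (1 + ‖ζ‖ ^ 2)⁻¹ := by
  have h : HasFDerivAt fsPotential ((1 + ‖ζ‖ ^ 2)⁻¹ • (2 • innerSL ℝ ζ)) ζ :=
    ((hasStrictFDerivAt_norm_sq ζ).hasFDerivAt.const_add 1).log (by positivity)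
  rw [h.fderiv]
  simp only [smul_apply, coe_innerSL_apply, nsmul_eq_mul, Nat.cast_ofNat, smul_eq_mul]
  ring

lemma secondDirDeriv_fsPotential (ζ v : ℂ) :
    secondDirDeriv fsPotential ζ v =
      (2 * ‖v‖ ^ 2 * (1 + ‖ζ‖ ^ 2) - (2 * ⟪ζ, v⟫) ^ 2) / (1 + ‖ζ‖ ^ 2) ^ 2 := by
  have hne : 1 + ‖ζ‖ ^ 2 ≠ 0 := by positivity
  have hnum : HasFDerivAt (fun q : ℂ => 2 * ⟪q, v⟫) ((2 : ℝ) • innerSL ℝ v) ζ := by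
    simp only [real_inner_comm v]
    exact (innerSL ℝ v).hasFDerivAt.const_mul 2
  have hden : HasFDerivAt (fun q : ℂ => 1 + ‖q‖ ^ 2) (2 • innerSL ℝ ζ) ζ :=
    (hasStrictFDerivAt_norm_sq ζ).hasFDerivAt.const_add 1
  have hquot := hnum.mul ((hasDerivAt_inv hne).comp_hasFDerivAt ζ hden)
  simp only [secondDirDeriv, fderiv_fsPotential_apply]
  refine (congrArg (· v) hquot.fderiv).trans ?_
  simp only [add_apply, smul_apply, coe_innerSL_apply, real_inner_self_eq_norm_sq, nsmul_eq_mul,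
    Nat.cast_ofNat, smul_eq_mul, Function.comp_apply]
  field_simp
  ring

lemma ddc_fsPotential (ζ : ℂ) : ddc fsPotential ζ 1 = 1 / (Real.pi * (1 + ‖ζ‖ ^ 2) ^ 2) := by
  have hsum : ⟪ζ, 1⟫ ^ 2 + ⟪ζ, Complex.I⟫ ^ 2 = ‖ζ‖ ^ 2 := by
    rw [Complex.sq_norm, Complex.normSq_apply]
    simp only [Complex.inner, one_mul, Complex.mul_re, Complex.conj_re, Complex.conj_im,
      Complex.I_re, Complex.I_im]
    ring
  rw [ddc_eq_secondDirDeriv contDiff_fsPotential.contDiffAt, secondDirDeriv_fsPotential,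
    secondDirDeriv_fsPotential, smul_eq_mul, mul_one, norm_one, Complex.norm_I, ← hsum]
  field_simp
  ring

lemma integral_ddc_fsPotential_mul_pos {χ : ℂ → ℝ} (hχ : Continuous χ)
    (hχc : HasCompactSupport χ) (hχ₀ : 0 ≤ χ) {ζ : ℂ} (hζ : χ ζ ≠ 0) :
    0 < ∫ ζ : ℂ, ddc fsPotential ζ 1 * χ ζ := by
  have hden : ∀ ζ : ℂ, 0 < Real.pi * (1 + ‖ζ‖ ^ 2) ^ 2 := fun ζ => by
    have := Real.pi_pos
    positivity
  simp only [ddc_fsPotential]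
  exact Continuous.integral_pos_of_hasCompactSupport_nonneg_nonzero
    ((continuous_const.div (by fun_prop) fun ζ => (hden ζ).ne').mul hχ) hχc.mul_left
    (fun ζ => mul_nonneg (one_div_nonneg.2 (hden ζ).le) (hχ₀ ζ))
    (mul_ne_zero (one_div_pos.2 (hden ζ)).ne' hζ)

end P1

namespace HMAE

open P1

lemma currentVanishesOn_of_eqOn {Φ : P1 × ℂ → EReal} {S : Set (P1 × ℂ)} (hS : IsOpen S)
    (h : ∀ κ ∈ charts, ∃ v : ℂ × ℂ → ℝ, ContDiffOn ℝ 2 v {q | (κ q.1, q.2) ∈ S} ∧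
      (∀ q : ℂ × ℂ, (κ q.1, q.2) ∈ S →
        Φ (κ q.1, q.2) = ((v q - fsPotential q.1 : ℝ) : EReal)) ∧
      ∀ q b : ℂ × ℂ, (κ q.1, q.2) ∈ S → ddc v q b = 0) :
    CurrentVanishesOn Φ S := by
  intro κ hκ
  obtain ⟨v, hv, hΦ, hddc⟩ := h κ hκ
  have hO : IsOpen {q : ℂ × ℂ | (κ q.1, q.2) ∈ S} :=
    hS.preimage (((continuous_of_mem_charts hκ).comp continuous_fst).prodMk continuous_snd)
  have hval : EqOn (fun q : ℂ × ℂ => fsPotential q.1 + (Φ (κ q.1, q.2)).toReal) v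
      {q | (κ q.1, q.2) ∈ S} := fun q hq => by
    simp only [hΦ q hq, EReal.toReal_coe, add_sub_cancel]
  have : (volume : Measure (ℂ × ℂ)).IsAddHaarMeasure := by
    rw [Measure.volume_eq_prod]
    infer_instance
  refine ⟨Eventually.of_forall fun q hq => ?_,
    (hv.continuousOn.congr hval).locallyIntegrableOn hO.measurableSet,
    fun χ hχ hχc hχS b => ?_⟩
  · rw [hΦ q hq]
    exact ⟨EReal.coe_ne_top _, EReal.coe_ne_bot _⟩
  · rw [integral_mul_ddc_congr (hval.mono hχS),
      integral_mul_ddc hO hv (contDiff_infty.1 hχ 2) hχc hχS b]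
    refine integral_eq_zero_of_ae (Eventually.of_forall fun q => ?_)
    by_cases hq : q ∈ tsupport χ
    · exact mul_eq_zero_of_left (hddc q b (hχS hq)) _
    · exact mul_eq_zero_of_right _ (image_eq_zero_of_notMem_tsupport hq)

lemma poleCandidate_chartZ {z : ℂ} (hz : z ≠ 0) (τ : ℂ) :
    poleCandidate (chartZ z, τ) = ((2 * Real.log ‖z‖ - fsPotential z : ℝ) : EReal) := by
  rw [poleCandidate, fsNormSq_chartZ, ENNReal.log_ofReal_of_pos (by positivity),
    Real.log_div (by positivity) (by positivity), Real.log_pow, Nat.cast_two, fsPotential]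

lemma currentVanishesOn_of_eqOn_poleCandidate {Φ : P1 × ℂ → EReal} {S : Set (P1 × ℂ)}
    (hS : IsOpen S) (hpole : ∀ τ, (chartZ 0, τ) ∉ S) (hΦ : EqOn Φ poleCandidate S) :
    CurrentVanishesOn Φ S := by
  have hne : ∀ q : ℂ × ℂ, (chartZ q.1, q.2) ∈ S → q.1 ≠ 0 := fun q hq h => hpole q.2 (h ▸ hq)
  refine currentVanishesOn_of_eqOn hS ?_
  rintro κ (rfl | rfl)
  · exact ⟨fun q => 2 * Real.log ‖q.1‖, contDiffOn_log_norm_fst.mono hne,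
      fun q hq => (hΦ hq).trans (poleCandidate_chartZ (hne q hq) _),
      fun q b hq => ddc_log_norm_fst (hne q hq) b⟩
  · refine ⟨fun _ => 0, contDiffOn_const, fun q hq => ?_, fun q b _ => ddc_const 0 q b⟩
    rw [hΦ hq, poleCandidate_chartW, zero_sub]

lemma not_strictlyPositive_of_eqOn {h : P1 → EReal} {r : ℝ} (hr : 0 < r)
    (hh : ∀ w ∈ ball (0 : ℂ) r, h (chartW w) = ((-fsPotential w : ℝ) : EReal)) :
    ¬ StrictlyPositive h := by
  rintro ⟨ε, hε, hpos⟩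
  obtain ⟨χ, hχr, hχc, hχ, hχ₀₁, hχ₁⟩ :=
    exists_contDiff_tsupport_subset (n := ⊤) (ball_mem_nhds (0 : ℂ) hr)
  have hχ₀ : 0 ≤ χ := fun ζ => (hχ₀₁ (mem_range_self ζ)).1
  have hval : EqOn (fun ζ : ℂ => (1 - ε) * fsPotential ζ + (h (chartW ζ)).toReal)
      (fun ζ => -ε * fsPotential ζ) (tsupport χ) := fun ζ hζ => by
    simp only [hh ζ (hχr hζ), EReal.toReal_coe]
    ring
  have hnonneg := hpos chartW (Or.inr rfl) χ hχ hχc hχ₀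
  rw [integral_mul_ddc_congr hval] at hnonneg
  simp only [mul_assoc] at hnonneg
  rw [integral_const_mul, integral_mul_ddc isOpen_univ contDiff_fsPotential.contDiffOn
    (contDiff_infty.1 hχ 2) hχc (subset_univ _)] at hnonneg
  have := integral_ddc_fsPotential_mul_pos hχ.continuous hχc hχ₀ (hχ₁ ▸ one_ne_zero)
  nlinarith

end HMAE

theorem theorem2p1_general {φ : P1 → ℝ}
    (hge : ∀ w : ℂ, -Real.log (1 + ‖w‖ ^ 2) ≤ φ (P1.chartW w)) {K : Set ℂ} (hK : IsCompact K)
    (hcap : HasPositiveCapacity K)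
    (hKφ : ∀ w ∈ K, φ (P1.chartW w) = -Real.log (1 + ‖w‖ ^ 2)) :
    ¬ HMAE.HasMaximalRank
        (HMAE.weakSolution (fun p : P1 × ℂ => φ (P1.rot p.2 p.1))) ∧
      ∃ S : Set (P1 × ℂ), IsOpen S ∧ S.Nonempty ∧ S ⊆ Set.univ ×ˢ Metric.ball (0 : ℂ) 1 ∧
        HMAE.CurrentVanishesOn
          (HMAE.weakSolution (fun p : P1 × ℂ => φ (P1.rot p.2 p.1))) S := by
  obtain ⟨r, hr, hr₁, hΦ⟩ := HMAE.exists_weakSolution_eq_poleCandidate hge hK hcap hKφ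
  have h₀ : (0 : ℂ) ∈ ball 0 r := mem_ball_self hr
  refine ⟨fun hrank => ?_, (P1.chartW '' ball 0 r) ×ˢ ball 0 r,
    (P1.isOpen_image_chartW_ball hr).prod isOpen_ball,
    ⟨(P1.chartW 0, 0), mem_image_of_mem _ h₀, h₀⟩,
    prod_mono (subset_univ _) (ball_subset_ball hr₁), ?_⟩
  · exact HMAE.not_strictlyPositive_of_eqOn hr
      (fun w hw => (hΦ ⟨mem_image_of_mem _ hw, h₀⟩).trans (HMAE.poleCandidate_chartW w 0))
      (hrank 0 (mem_closedBall_self zero_le_one))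
  · exact HMAE.currentVanishesOn_of_eqOn_poleCandidate
      ((P1.isOpen_image_chartW_ball hr).prod isOpen_ball)
      (fun τ ⟨⟨w, _, hw⟩, _⟩ => P1.chartW_ne_chartZ_zero w hw) hΦ

theorem theorem2p1 (φ : P1 → ℝ) (hφ : P1.Smooth φ) (hpos : HMAE.IsKahlerPotential φ)
    (hge : ∀ w : ℂ, -Real.log (1 + ‖w‖ ^ 2) ≤ φ (P1.chartW w))
    (harc : IsArc {w : ℂ | φ (P1.chartW w) = -Real.log (1 + ‖w‖ ^ 2)}) :
    ¬ HMAE.HasMaximalRank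
        (HMAE.weakSolution (fun p : P1 × ℂ => φ (P1.rot p.2 p.1))) ∧
      ∃ S : Set (P1 × ℂ), IsOpen S ∧ S.Nonempty ∧ S ⊆ Set.univ ×ˢ Metric.ball (0 : ℂ) 1 ∧
        HMAE.CurrentVanishesOn
          (HMAE.weakSolution (fun p : P1 × ℂ => φ (P1.rot p.2 p.1))) S :=
  theorem2p1_general hge harc.isCompact harc.hasPositiveCapacity fun _ h => h
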